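/- Let $0\le k\le n$ and let $P_1,\dots,P_k$, $Q_1,\dots,Q_k\in C^\infty(\mathbb R^n)$ be real functions with $$Q_i=\sum_j P_j\,\alpha_{ji},\qquad P_i=\sum_j Q_j\,\beta_{ji},\qquad \alpha\beta=\beta\alpha=1,$$ where $\alpha=(\alpha_{ij})$ and $\beta=(\beta_{ij})$ are $k\times k$ matrices of functions in $C^\infty(\mathbb R^n)$. Let $S=\{P_1=\dots=P_k=0\}=\{Q_1=\dots=Q_k=0\}$, and assume that the families $P_i=\mathrm{const}$ and $Q_i=\mathrm{const}$ form correct grids: near every point of $S$ the functions $P_1,\dots,P_k$ can be completed to a smooth local coordinate system of $\mathbb R^n$, and so can $Q_1,\dots,Q_k$. Thus $S$ is an $(n-k)$-dimensional surface. Fix an orientation of $S$, given by a continuous $(n-k)$-form along $S$ that is nonzero on each tangent space. The distributions $\delta_{i_1\dots i_s}(P)=\dfrac{\partial^s\delta(P)}{\partial P_{i_1}\cdots\partial P_{i_s}}$ concentrated on $S$ are defined as follows. If a test function $\varphi$ is supported in the domain of a local coordinate system $(u_1,\dots,u_k,v_1,\dots,v_{n-k})$ with $u_i=P_i$, then $$\langle\delta_{i_1\dots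 i_s}(P),\varphi\rangle=(-1)^s\int_S\frac{\partial^s}{\partial u_{i_1}\cdots\partial u_{i_s}}\Bigl[\varphi\,\det\frac{\partial x}{\partial(u,v)}\Bigr]_{u=0}dv_1\wedge\dots\wedge dv_{n-k},$$ the integral being taken over $S$ with the chosen orientation. In particular $\langle\delta(P),\varphi\rangle=\int_S\varphi\,\omega$, where $dP_1\wedge\dots\wedge dP_k\wedge\omega=dx_1\wedge\dots\wedge dx_n$. For a general test function $\varphi\in C_c^\infty(\mathbb R^n)$ one decomposes $\varphi$ by any smooth locally finite partition of unity, on a neighbourhood of $S$, subordinate to such coordinate systems. The distributions $\delta_{i_1\dots i_s}(Q)$ are defined in the same way, with the same orientation of $S$. Then, for all $s\ge 0$ and $i_1,\dots,i_s\in\{1,\dots,k\}$, whichever coordinate systems and partitions of unity are used on the two sides, $$\delta_{i_1\dots i_s}(Q)=\det\beta\cdot\sum_{j_1,\dots,j_s=1}^k\beta_{i_1j_1}\cdots\beta_{i_sj_s}\,\delta_{j_1\dots j_s}(P).$$ Moreover, writing $\delta^{(p_1\dots p_k)}(P)=\dfrac{\partial^{p_1+\dots+p_k}\delta(P)}{\partial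 P_1^{p_1}\cdots\partial P_k^{p_k}}$ and likewise for $Q$, for all nonnegative integers $q_1,\dots,q_k$, $$\delta^{(q_1\dots q_k)}(Q)=\det\beta\cdot\sum_{(r_{ij})}\ \prod_{i=1}^k q_i!\prod_{j=1}^k\frac{\beta_{ij}^{\,r_{ij}}}{r_{ij}!}\ \delta^{(p_1\dots p_k)}(P),\qquad p_j=\sum_{i=1}^k r_{ij},$$ where the sum is over all $k\times k$ matrices $(r_{ij})$ of nonnegative integers with $\sum_{j=1}^k r_{ij}=q_i$ for every $i$. -/

import Mathlib

open scoped ContDiff Topology Manifold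

noncomputable section

/-- The common zero set `S = {x : P₁ x = … = P_k x = 0}` in `ℝⁿ`, where `n = k + m`. -/
def zeroSurface {k m : ℕ} (P : Fin k → (Fin (k + m) → ℝ) → ℝ) : Set (Fin (k + m) → ℝ) :=
  {x | ∀ i, P i x = 0}

/-- A smooth local coordinate system `(u₁, …, u_k, v₁, …, v_m)` of `ℝⁿ` whose first `k`
coordinates are `P₁, …, P_k`. -/
structure AdaptedChart {k m : ℕ} (P : Fin k → (Fin (k + m) → ℝ) → ℝ) where
  /-- the coordinate map -/
  toChart : OpenPartialHomeomorph (Fin (k + m) → ℝ) (Fin (k + m) → ℝ)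
  smooth : ContDiffOn ℝ ∞ toChart toChart.source
  smooth_symm : ContDiffOn ℝ ∞ toChart.symm toChart.target
  coord_eq : ∀ x ∈ toChart.source, ∀ i : Fin k, toChart x (Fin.castAdd m i) = P i x

/-- The hypersurfaces `P_i = const` form a correct grid: around every point of the surface
`P = 0` the functions `P₁, …, P_k` can be completed to a smooth local coordinate system. -/
def CorrectGrid {k m : ℕ} (P : Fin k → (Fin (k + m) → ℝ) → ℝ) : Prop :=
  ∀ x ∈ zeroSurface P, ∃ Φ : AdaptedChart P, x ∈ Φ.toChart.source

/-- A continuous `m`-form along `S` that is nonzero on every tangent space of `S`,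
`T_x S = {w : dP₁(w) = … = dP_k(w) = 0}`. The orientation of `S` that it defines declares a tangent
frame positive if the form is positive on it. -/
def OrientsSurface {k m : ℕ} (P : Fin k → (Fin (k + m) → ℝ) → ℝ)
    (Ω : (Fin (k + m) → ℝ) → (Fin (k + m) → ℝ) [⋀^Fin m]→L[ℝ] ℝ) : Prop :=
  ContinuousOn Ω (zeroSurface P) ∧
    ∀ x ∈ zeroSurface P, ∃ w : Fin m → (Fin (k + m) → ℝ),
      (∀ l i, fderiv ℝ (P i) x (w l) = 0) ∧ Ω x w ≠ 0

/-- Iterated partial derivative `∂_{i₁} ⋯ ∂_{i_s} g` for the list `[i₁, …, i_s]`. -/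
def iterPartial {d : ℕ} : List (Fin d) → ((Fin d → ℝ) → ℝ) → (Fin d → ℝ) → ℝ
  | [], g => g
  | i :: I, g => fun y => fderiv ℝ (iterPartial I g) y (Pi.single i 1)

/-- A function `f` supported in the domain of the chart, multiplied by the Jacobian
`D(x; u, v) = det (∂x / ∂(u, v))`, written in the coordinates `(u, v)` and extended by zero. -/
def AdaptedChart.density {k m : ℕ} {P : Fin k → (Fin (k + m) → ℝ) → ℝ} (Φ : AdaptedChart P)
    (f : (Fin (k + m) → ℝ) → ℝ) : (Fin (k + m) → ℝ) → ℝ :=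
  Φ.toChart.target.indicator fun y =>
    f (Φ.toChart.symm y) * (fderiv ℝ Φ.toChart.symm y).det

/-- The sign (`1` or `-1`) of the coordinate frame `∂x/∂v₁, …, ∂x/∂v_m` of the surface at the point
with coordinates `y`, with respect to the orientation given by `Ω`. -/
def AdaptedChart.frameSign {k m : ℕ} {P : Fin k → (Fin (k + m) → ℝ) → ℝ} (Φ : AdaptedChart P)
    (Ω : (Fin (k + m) → ℝ) → (Fin (k + m) → ℝ) [⋀^Fin m]→L[ℝ] ℝ) (y : Fin (k + m) → ℝ) : ℝ :=
  Real.sign (Ω (Φ.toChart.symm y) fun l : Fin m =>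
    fderiv ℝ Φ.toChart.symm y (Pi.single (Fin.natAdd k l) 1))

/-- For `f` smooth with compact support in the domain of the chart, the value on `f` of
`∂^s δ(P) / ∂P_{i₁} ⋯ ∂P_{i_s}`, that is
`(-1)^s ∫_S (∂^s (f D(x; u, v)) / ∂u_{i₁} ⋯ ∂u_{i_s}) |_{u = 0} dv₁ ∧ ⋯ ∧ dv_m`,
the integral being taken over the oriented surface. For `s = 0` the integrand is `f ω`, where
`ω = D(x; u, v) dv₁ ∧ ⋯ ∧ dv_m` satisfies `dP₁ ∧ ⋯ ∧ dP_k ∧ ω = dx₁ ∧ ⋯ ∧ dx_n`. -/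
def AdaptedChart.localDelta {k m : ℕ} {P : Fin k → (Fin (k + m) → ℝ) → ℝ} (Φ : AdaptedChart P)
    (Ω : (Fin (k + m) → ℝ) → (Fin (k + m) → ℝ) [⋀^Fin m]→L[ℝ] ℝ) (I : List (Fin k))
    (f : (Fin (k + m) → ℝ) → ℝ) : ℝ :=
  (-1) ^ I.length * ∫ v : Fin m → ℝ,
    Φ.frameSign Ω (Fin.append (0 : Fin k → ℝ) v) *
      iterPartial (I.map (Fin.castAdd m)) (Φ.density f) (Fin.append (0 : Fin k → ℝ) v)

/-- Local coordinate systems containing `P₁, …, P_k` among their coordinates, together with a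
subordinate smooth locally finite partition of unity on a neighbourhood of the surface `P = 0`. -/
structure GridAtlas {k m : ℕ} (P : Fin k → (Fin (k + m) → ℝ) → ℝ) where
  ι : Type
  chart : ι → AdaptedChart P
  weight : ι → (Fin (k + m) → ℝ) → ℝ
  weight_smooth : ∀ a, ContDiff ℝ ∞ (weight a)
  locallyFinite : LocallyFinite fun a => Function.support (weight a)
  subordinate : ∀ a, tsupport (weight a) ⊆ (chart a).toChart.source
  sum_eq_one : ∀ᶠ x in 𝓝ˢ (zeroSurface P), ∑ᶠ a, weight a x = 1

/-- The value of `δ_{i₁ ⋯ i_s}(P) = ∂^s δ(P) / ∂P_{i₁} ⋯ ∂P_{i_s}` on the test function `φ`; here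
`I = [i₁, …, i_s]`, and the surface carries the orientation given by `Ω`. -/
def GridAtlas.delta {k m : ℕ} {P : Fin k → (Fin (k + m) → ℝ) → ℝ} (A : GridAtlas P)
    (Ω : (Fin (k + m) → ℝ) → (Fin (k + m) → ℝ) [⋀^Fin m]→L[ℝ] ℝ) (I : List (Fin k))
    (φ : (Fin (k + m) → ℝ) → ℝ) : ℝ :=
  ∑ᶠ a, (A.chart a).localDelta Ω I fun x => A.weight a x * φ x

/-- The list `1, …, 1, 2, …, 2, …, k, …, k` with `q_i` copies of `i`, so that `∂^q` is the
iterated derivative along this list. -/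
def multiIndexList {k : ℕ} (q : Fin k → ℕ) : List (Fin k) :=
  (List.finRange k).flatMap fun i => List.replicate (q i) i

/-- Every correct grid has an atlas with a partition of unity as above. -/
theorem CorrectGrid.nonempty_gridAtlas {k m : ℕ} {P : Fin k → (Fin (k + m) → ℝ) → ℝ}
    (hs : ∀ i, ContDiff ℝ ∞ (P i)) (h : CorrectGrid P) : Nonempty (GridAtlas P) := by
  classical
  have hclosed : IsClosed (zeroSurface P) := by
    have : zeroSurface P = ⋂ i, {x | P i x = 0} := by ext x; simp [zeroSurface]
    rw [this]
    exact isClosed_iInter fun i => isClosed_eq (hs i).continuous continuous_const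
  choose Φ hΦ using h
  let U : Option (zeroSurface P) → Set (Fin (k + m) → ℝ) := fun o =>
    o.elim (zeroSurface P)ᶜ fun x => (Φ x x.2).toChart.source
  obtain ⟨ρ, hρ⟩ := SmoothPartitionOfUnity.exists_isSubordinate 𝓘(ℝ, Fin (k + m) → ℝ)
    (s := Set.univ) isClosed_univ U
    (by
      rintro (_ | x)
      · exact hclosed.isOpen_compl
      · exact (Φ x x.2).toChart.open_source)
    (by
      intro x _
      by_cases hx : x ∈ zeroSurface P
      · exact Set.mem_iUnion.2 ⟨some ⟨x, hx⟩, hΦ x hx⟩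
      · exact Set.mem_iUnion.2 ⟨none, hx⟩)
  refine ⟨⟨zeroSurface P, fun x => Φ x x.2, fun x => ρ (some x), fun x => ?_, ?_, ?_, ?_⟩⟩
  · exact (ρ (some x)).contMDiff.contDiff
  · exact ρ.locallyFinite.comp_injective (Option.some_injective _)
  · exact fun x => hρ (some x)
  · have hn : (tsupport (ρ none))ᶜ ∈ 𝓝ˢ (zeroSurface P) :=
      (isClosed_tsupport _).isOpen_compl.mem_nhdsSet.2 fun x hx hx' => hρ none hx' hx
    filter_upwards [hn] with x hx
    have h0 : ρ none x = 0 := image_eq_zero_of_notMem_tsupport hx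
    have h1 := ρ.sum_eq_one (Set.mem_univ x)
    have hfin : (Function.support fun o => ρ o x).Finite := ρ.locallyFinite.point_finite x
    have hfin' : Function.HasFiniteSupport ((fun o => ρ o x) ∘ some) :=
      hfin.preimage (Option.some_injective _).injOn
    rw [← h1, finsum_option hfin', h0, zero_add]

end

/-! Treat the derivatives of `δ(P)` as polynomials in commuting symbols `p₁, …, p_k` whose
coefficients are smooth functions, and let `T` be the functional sending `f p^J` to `⟨δ_J(P), f⟩`.
Two rules govern `T`. Multiplication by `P_b` acts as `-∂/∂p_b`, since in adapted coordinates it is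
multiplication by `u_b`, which vanishes on the surface. The chain rule `∂ⱼ δ_J(P) = ∑ₗ (∂ⱼ Pₗ)
δ_{lJ}(P)` holds in adjoint form: by the Piola identity, `∂ⱼ f` times the Jacobian is a divergence
in the coordinates `(u, v)`, and its `v`-part integrates to zero over the surface.
`IsDeltaFunctional` records these two rules.

In symbols the claim is that `δ_I(Q)` corresponds to `det β · ∏ (∑ⱼ βᵢⱼ pⱼ)`, with `i` running
through `I`. It follows by induction on `s` in `IsDeltaFunctional.transform`. A vector field `Yᵢ`
with `Yᵢ Qₗ = 1` for `l = i` and `0` otherwise turns `δ_I(Q)` into `δ_{iI}(Q)`. Applied to the right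
side, it meets `∂Pₗ = ∑ₐ (∂Qₐ βₐₗ + Qₐ ∂βₐₗ)`. The first summand contributes the new factor `∑ₗ βᵢₗ
pₗ`. In the second, `Qₐ = ∑ P_b α_{ba}` becomes a derivative in the symbols, and Jacobi's formula
for `det β` shows that it cancels the derivatives of the coefficients of the polynomial
(`IsDeltaFunctional.cancel`).

The case `s = 0` (`localDelta_nil_transform`) is a change of variables on the surface. Along it `dQ`
is `dP` times `α`, so the Jacobian of two adapted charts is block triangular; the orientation signs
absorb the absolute value in the substitution formula.

All this is local, on functions supported in a chart of each grid. Multiplying the two partitions of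
unity reduces the global law to that case and makes the result independent of the choices
(`GridAtlas.delta_transform`). Expanding the product of linear forms term by term, or by the
multinomial theorem, gives the two formulas. -/

noncomputable section

/-! ### Derivations acting on the coefficients of polynomials. -/

namespace MvPolynomial

variable {σ R : Type*} [CommRing R]

/-- The additive map on polynomials that sends `monomial d c` to `F d c`. -/
def sumMonomials {A : Type*} [AddCommMonoid A] (F : (σ →₀ ℕ) → R →+ A) :
    MvPolynomial σ R →+ A where
  toFun p := ∑ d ∈ p.support, F d (coeff d p)
  map_zero' := by simp
  map_add' p q := by
    classical
    have key : ∀ r : MvPolynomial σ R, ∀ s : Finset (σ →₀ ℕ), r.support ⊆ s →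
        ∑ d ∈ r.support, F d (coeff d r) = ∑ d ∈ s, F d (coeff d r) := fun r s hs =>
      Finset.sum_subset hs fun d _ hd => by rw [notMem_support_iff.1 hd, map_zero]
    rw [key _ _ support_add, key p _ Finset.subset_union_left,
      key q _ Finset.subset_union_right, ← Finset.sum_add_distrib]
    simp

theorem sumMonomials_monomial {A : Type*} [AddCommMonoid A] (F : (σ →₀ ℕ) → R →+ A)
    (d : σ →₀ ℕ) (c : R) : sumMonomials F (monomial d c) = F d c := by
  classical
  change ∑ e ∈ (monomial d c).support, F e (coeff e (monomial d c)) = _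
  rw [Finset.sum_subset (support_monomial_subset (s := d) (a := c))
    fun e _ he => by rw [notMem_support_iff.1 he, map_zero]]
  simp

/-- Derivations of a commutative ring. -/
abbrev _root_.RingDerivation (R : Type*) [CommRing R] := Derivation ℤ R R

/-- A derivation of the coefficient ring applied to the coefficients of a polynomial. -/
def mapDerivation (D : RingDerivation R) : MvPolynomial σ R →+ MvPolynomial σ R :=
  sumMonomials fun d => (monomial d).toAddMonoidHom.comp D.toLinearMap.toAddMonoidHom

theorem mapDerivation_monomial (D : RingDerivation R) (d : σ →₀ ℕ) (c : R) :
    mapDerivation D (monomial d c) = monomial d (D c) :=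
  sumMonomials_monomial _ d c

theorem mapDerivation_mul (D : RingDerivation R) (p q : MvPolynomial σ R) :
    mapDerivation D (p * q) = p * mapDerivation D q + q * mapDerivation D p := by
  induction p using MvPolynomial.induction_on' with
  | add p₁ p₂ h₁ h₂ => rw [add_mul, map_add, h₁, h₂, map_add]; ring
  | monomial d c =>
    induction q using MvPolynomial.induction_on' with
    | add q₁ q₂ h₁ h₂ => rw [mul_add, map_add, h₁, h₂, map_add]; ring
    | monomial e c' =>
      simp only [monomial_mul, mapDerivation_monomial, Derivation.leibniz, smul_eq_mul, map_add]
      rw [add_comm e d]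

theorem mapDerivation_C (D : RingDerivation R) (c : R) :
    mapDerivation (σ := σ) D (C c) = C (D c) :=
  mapDerivation_monomial D 0 c

theorem mapDerivation_X (D : RingDerivation R) (i : σ) : mapDerivation D (X i) = 0 := by
  rw [X, mapDerivation_monomial, Derivation.map_one_eq_zero, monomial_zero]

end MvPolynomial

open MvPolynomial

/-! ### Symbolic calculus of derivatives of delta functions and the induction on `s`. -/

section Symbols

variable {R κ ι : Type*} [CommRing R] [Fintype κ]

/-- The linear form `∑ⱼ βᵢⱼ pⱼ` in the symbols `p`. -/
def symbolForm (β : Matrix κ κ R) (i : κ) : MvPolynomial κ R :=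
  ∑ j, C (β i j) * X j

theorem mapDerivation_symbolForm (D : RingDerivation R) (β : Matrix κ κ R) (i : κ) :
    mapDerivation D (symbolForm β i) = ∑ j, C (D (β i j)) * X j := by
  simp [symbolForm, mapDerivation_mul, mapDerivation_C, mapDerivation_X, mul_comm]

theorem pderiv_symbolForm (β : Matrix κ κ R) (i b : κ) :
    pderiv b (symbolForm β i) = C (β i b) := by
  classical
  simp [symbolForm, Derivation.leibniz, pderiv_X, Pi.single_apply]

/-- Differentiating the coefficients of a product of the forms `∑ⱼ βᵢⱼ pⱼ` amounts to a vector
field in the symbols. -/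
theorem mapDerivation_prod_symbolForm [DecidableEq κ] (D : RingDerivation R) {α β : Matrix κ κ R}
    (hβα : β * α = 1) (I : List κ) :
    mapDerivation D (I.map (symbolForm β)).prod =
      ∑ a, ∑ b, C (α b a) * mapDerivation D (symbolForm β a) *
        pderiv b (I.map (symbolForm β)).prod := by
  induction I with
  | nil =>
    have : (1 : MvPolynomial κ R) = C 1 := by simp
    simp only [List.map_nil, List.prod_nil]
    rw [this, mapDerivation_C]
    simp
  | cons c I ih =>
    -- Both sides of the claim obey the product rule, so a single linear form is enough; there `β α
    -- = 1` leaves only the term `a = c`.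
    have h : ∑ a, ∑ b, C (α b a) * mapDerivation D (symbolForm β a) *
        pderiv b (symbolForm β c) = mapDerivation D (symbolForm β c) := by
      have h1 : ∀ a, ∑ b, C (α b a) * mapDerivation D (symbolForm β a) *
          pderiv b (symbolForm β c) =
          C ((β * α) c a) * mapDerivation D (symbolForm β a) := fun a => by
        rw [Matrix.mul_apply, map_sum, Finset.sum_mul]
        refine Finset.sum_congr rfl fun b _ => ?_
        rw [pderiv_symbolForm, C_mul]; ring
      simp only [h1, hβα, Matrix.one_apply]
      simp
    simp only [List.map_cons, List.prod_cons]
    rw [mapDerivation_mul, ih, ← h, Finset.mul_sum, Finset.mul_sum, ← Finset.sum_add_distrib]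
    refine Finset.sum_congr rfl fun a _ => ?_
    rw [Finset.mul_sum, Finset.mul_sum, ← Finset.sum_add_distrib]
    refine Finset.sum_congr rfl fun b _ => ?_
    rw [Derivation.leibniz, smul_eq_mul, smul_eq_mul]; ring

/-- The conditions under which an additive functional on polynomials in symbols `p` behaves like
`f p^J ↦ ⟨δ_J(P), f⟩`, the coefficients of the arguments lying in an ideal `𝔪`: the product rule
`P_b δ_J(P) = -∂_{p_b}` and the chain rule for the derivatives of `δ_J(P)`. -/
structure IsDeltaFunctional {A : Type*} [AddCommGroup A] (D : ι → RingDerivation R) (𝔪 : Ideal R)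
    (P : κ → R) (T : MvPolynomial κ R →+ A) : Prop where
  mul_coord : ∀ b, ∀ g ∈ 𝔪, ∀ τ, T (C (P b) * (C g * τ)) = -T (pderiv b (C g * τ))
  chain_rule : ∀ j, ∀ g ∈ 𝔪, ∀ τ,
    T (∑ l, C (D j (P l)) * X l * (C g * τ)) = -T (mapDerivation (D j) (C g * τ))

variable {A : Type*} [AddCommGroup A] {D : ι → RingDerivation R} {𝔪 : Ideal R}
  {P Q : κ → R} {T U : MvPolynomial κ R →+ A}

/-- Writing `Qₐ` through the `P_b` turns each summand into a total derivative in the symbols. That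
derivative reproduces what the coefficients of `det β · ∏ (∑ βᵢⱼ pⱼ)` yield under `D j`, so the
unwanted terms of the induction step cancel. -/
theorem IsDeltaFunctional.cancel [DecidableEq κ] (hT : IsDeltaFunctional D 𝔪 P T)
    {α β : Matrix κ κ R} (hQP : ∀ a, Q a = ∑ b, P b * α b a) (hβα : β * α = 1)
    (hdet : ∀ j, D j β.det = β.det * ∑ a, ∑ b, α b a * D j (β a b))
    (j : ι) (I : List κ) {g : R} (hg : g ∈ 𝔪) :
    T (∑ l, ∑ a, C (Q a) * C (D j (β a l)) * X l * (C g * (C β.det * (I.map (symbolForm β)).prod)))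
      = -T (C g * mapDerivation (D j) (C β.det * (I.map (symbolForm β)).prod)) := by
  set m := (I.map (symbolForm β)).prod with hm
  have h1 : ∑ l, ∑ a, C (Q a) * C (D j (β a l)) * X l * (C g * (C β.det * m)) =
      ∑ a, ∑ b, C (P b) * (C g * (C (α b a) * mapDerivation (D j) (symbolForm β a) *
        (C β.det * m))) := by
    rw [Finset.sum_comm]
    refine Finset.sum_congr rfl fun a _ => ?_
    simp only [hQP a, mapDerivation_symbolForm, map_sum, C_mul, Finset.sum_mul, Finset.mul_sum]
    rw [Finset.sum_comm]
    refine Finset.sum_congr rfl fun b _ => Finset.sum_congr rfl fun l _ => ?_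
    ring
  -- Where `∂/∂p_b` hits the differentiated linear form it gives `∑ α D β`, hence `D (det β)` by
  -- `hdet`; where it hits `m` it gives `D m` by `mapDerivation_prod_symbolForm`.
  have hid : ∑ a, ∑ b, pderiv b (C g * (C (α b a) * mapDerivation (D j) (symbolForm β a) *
      (C β.det * m))) = C g * mapDerivation (D j) (C β.det * m) := by
    rw [mapDerivation_mul, mapDerivation_C, hm, mapDerivation_prod_symbolForm (D j) hβα, ← hm, hdet,
      mul_add, C_mul, add_comm (C g * _)]
    simp only [map_sum, Finset.mul_sum, ← Finset.sum_add_distrib]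
    refine Finset.sum_congr rfl fun a _ => Finset.sum_congr rfl fun b _ => ?_
    have h2 : pderiv b (mapDerivation (D j) (symbolForm β a)) = C (D j (β a b)) := by
      rw [mapDerivation_symbolForm]
      exact pderiv_symbolForm (fun a b => D j (β a b)) a b
    simp only [Derivation.leibniz, pderiv_C, smul_eq_mul, h2, C_mul]
    ring
  rw [h1, ← hid]
  simp only [map_sum, hT.mul_coord _ g hg, Finset.sum_neg_distrib]

/-- The transformation law for `δ_I(Q)`, deduced from the case `s = 0`. -/
theorem IsDeltaFunctional.transform [DecidableEq κ] [Fintype ι]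
    (hT : IsDeltaFunctional D 𝔪 P T) (hU : IsDeltaFunctional D 𝔪 Q U)
    (h𝔪 : ∀ j, ∀ g ∈ 𝔪, D j g ∈ 𝔪)
    {α β : Matrix κ κ R} (hQP : ∀ a, Q a = ∑ b, P b * α b a) (hPQ : ∀ l, P l = ∑ a, Q a * β a l)
    (hβα : β * α = 1) (hdet : ∀ j, D j β.det = β.det * ∑ a, ∑ b, α b a * D j (β a b))
    (Y : κ → ι → R)
    (hY : ∀ i l, ∀ g ∈ 𝔪, ∑ j, g * Y i j * D j (Q l) = g * (1 : Matrix κ κ R) i l)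
    (hbase : ∀ g ∈ 𝔪, U (C g) = T (C (β.det * g))) (I : List κ) :
    ∀ g ∈ 𝔪, U (C g * (I.map X).prod) = T (C (β.det * g) * (I.map (symbolForm β)).prod) := by
  induction I with
  | nil => intro g hg; simpa using hbase g hg
  | cons i I ih =>
    intro g hg
    set m := (I.map (symbolForm β)).prod with hm
    set n : MvPolynomial κ R := (I.map X).prod with hn
    have hgY : ∀ j, g * Y i j ∈ 𝔪 := fun j => 𝔪.mul_mem_right _ hg
    have hDn : ∀ j, mapDerivation (D j) n = 0 := fun j => by
      rw [hn]
      clear ih hm hn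
      induction I with
      | nil =>
        have : (1 : MvPolynomial κ R) = C 1 := by simp
        simp only [List.map_nil, List.prod_nil]
        rw [this, mapDerivation_C]
        simp
      | cons c I h => simp [mapDerivation_mul, mapDerivation_X, h]
    -- The symbol `Xᵢ` is written as the contraction of `∑ₗ (D j Qₗ) Xₗ` with the field `Yᵢ`, the
    -- shape to which the chain rule for `U` applies.
    have hL : C g * ((i :: I).map X).prod =
        ∑ j, ∑ l, C (D j (Q l)) * X l * (C (g * Y i j) * n) := by
      rw [Finset.sum_comm]
      have h1 : ∀ l, ∑ j, C (D j (Q l)) * X l * (C (g * Y i j) * n) =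
          C (g * (1 : Matrix κ κ R) i l) * X l * n := fun l => by
        rw [← hY i l g hg, map_sum, Finset.sum_mul, Finset.sum_mul]
        refine Finset.sum_congr rfl fun j _ => ?_
        rw [C_mul (a := g * Y i j)]; ring
      simp only [h1, Matrix.one_apply, mul_ite, mul_one, mul_zero, apply_ite C, map_zero, ite_mul, zero_mul,
        Finset.sum_ite_eq, Finset.mem_univ, if_true]
      rw [List.map_cons, List.prod_cons, mul_assoc]
    have hU1 : U (C g * ((i :: I).map X).prod) =
        -∑ j, T (C (D j (g * Y i j)) * (C β.det * m)) := by
      rw [hL, map_sum, ← Finset.sum_neg_distrib]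
      refine Finset.sum_congr rfl fun j _ => ?_
      rw [hU.chain_rule j _ (hgY j), mapDerivation_mul, hDn, mul_zero, zero_add, mapDerivation_C,
        mul_comm n, ih _ (h𝔪 j _ (hgY j)), C_mul]
      congr 2; ring
    have hcancel := fun j => hT.cancel hQP hβα hdet j I (hgY j)
    -- The product rule for `Pₗ = ∑ Qₐ βₐₗ`, contracted with `Yᵢ`: the terms with `D j Qₐ` collapse
    -- to the form of index `i`, and those with `Qₐ` are the ones treated by `cancel`.
    have hR : C (β.det * g) * ((i :: I).map (symbolForm β)).prod +
        ∑ j, ∑ l, ∑ a, C (Q a) * C (D j (β a l)) * X l * (C (g * Y i j) * (C β.det * m)) =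
        ∑ j, ∑ l, C (D j (P l)) * X l * (C (g * Y i j) * (C β.det * m)) := by
      have h1 : ∀ j l, C (D j (P l)) * X l * (C (g * Y i j) * (C β.det * m)) =
          ∑ a, C (g * Y i j * D j (Q a)) * (C (β a l) * X l * (C β.det * m)) +
          ∑ a, C (Q a) * C (D j (β a l)) * X l * (C (g * Y i j) * (C β.det * m)) := fun j l => by
        rw [hPQ l, map_sum, map_sum, Finset.sum_mul, Finset.sum_mul, ← Finset.sum_add_distrib]
        refine Finset.sum_congr rfl fun a _ => ?_
        simp only [Derivation.leibniz, smul_eq_mul, C_mul, C_add]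
        ring
      simp only [h1, Finset.sum_add_distrib]
      congr 1
      have h2 : ∀ l a, ∑ j, C (g * Y i j * D j (Q a)) * (C (β a l) * X l * (C β.det * m)) =
          C (g * (1 : Matrix κ κ R) i a) * (C (β a l) * X l * (C β.det * m)) := fun l a => by
        rw [← hY i a g hg, map_sum, Finset.sum_mul]
      rw [Finset.sum_comm]
      have h3 : ∀ l, ∑ j, ∑ a, C (g * Y i j * D j (Q a)) * (C (β a l) * X l * (C β.det * m)) =
          C g * (C (β i l) * X l * (C β.det * m)) := fun l => by
        rw [Finset.sum_comm]
        simp only [h2, Matrix.one_apply, mul_ite, mul_one, mul_zero, apply_ite C, map_zero, ite_mul, zero_mul,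
          Finset.sum_ite_eq, Finset.mem_univ, if_true]
      simp only [h3]
      rw [List.map_cons, List.prod_cons, symbolForm, Finset.sum_mul, Finset.mul_sum]
      refine Finset.sum_congr rfl fun l _ => ?_
      rw [C_mul]; ring
    rw [← add_right_cancel_iff (a := T (∑ j, ∑ l, ∑ a,
      C (Q a) * C (D j (β a l)) * X l * (C (g * Y i j) * (C β.det * m)))), ← map_add, hR, hU1,
      map_sum, map_sum, ← Finset.sum_neg_distrib, ← Finset.sum_add_distrib]
    refine Finset.sum_congr rfl fun j _ => ?_
    rw [hcancel j, hT.chain_rule j _ (hgY j), mapDerivation_mul (D j) (C (g * Y i j)),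
      mapDerivation_C, map_add, mul_comm (C β.det * m) (C _)]
    abel

end Symbols

/-- The Leibniz expansion is differentiated factor by factor and sorted by the column that is hit.
Each part is the determinant with that column replaced by its derivative, which Cramer's rule writes
through the adjugate. -/
theorem HasFDerivAt.matrix_det {E n : Type*} [NormedAddCommGroup E] [NormedSpace ℝ E] [Fintype n]
    [DecidableEq n] {M : E → Matrix n n ℝ} {M' : n → n → E →L[ℝ] ℝ} {x : E}
    (h : ∀ i j, HasFDerivAt (fun y => M y i j) (M' i j) x) :
    HasFDerivAt (fun y => (M y).det) (∑ i, ∑ j, (M x).adjugate j i • M' i j) x := by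
  have h1 : HasFDerivAt (fun y => (M y).det)
      (∑ s : Equiv.Perm n, (Equiv.Perm.sign s : ℝ) •
        ∑ j, (∏ i ∈ Finset.univ.erase j, M x (s i) i) • M' (s j) j) x := by
    have : (fun y => (M y).det) = fun y => ∑ s : Equiv.Perm n, (Equiv.Perm.sign s : ℝ) *
        ∏ i, M y (s i) i := by
      ext y; rw [Matrix.det_apply']
    rw [this]
    refine HasFDerivAt.fun_sum fun s _ => HasFDerivAt.const_mul ?_ _
    exact HasFDerivAt.finsetProd fun i _ => h (s i) i
  refine h1.congr_fderiv ?_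
  ext v
  have h2 : ∀ j, ∑ i, (M x).adjugate j i * M' i j v =
      ((M x).updateCol j fun i => M' i j v).det := fun j => by
    rw [← Matrix.cramer_apply, Matrix.cramer_eq_adjugate_mulVec]; rfl
  simp only [sum_apply, smul_apply, smul_eq_mul]
  rw [Finset.sum_comm (s := Finset.univ (α := n))]
  simp only [h2, Matrix.det_apply', Finset.mul_sum]
  rw [Finset.sum_comm]
  refine Finset.sum_congr rfl fun j _ => Finset.sum_congr rfl fun s _ => ?_
  rw [← Finset.mul_prod_erase _ _ (Finset.mem_univ j), Matrix.updateCol_self]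
  rw [Finset.prod_congr rfl fun i hi => Matrix.updateCol_ne (Finset.ne_of_mem_erase hi)]
  ring

theorem minSmoothness_two_le_infty : minSmoothness ℝ 2 ≤ ∞ := by
  rw [minSmoothness_of_isRCLikeNormedField]
  exact WithTop.coe_le_coe.2 le_top

/-! ### The ring of smooth functions and its iterated partial derivatives. -/

/-- The ring of smooth functions on `ℝᵈ`. -/
def smoothFunctions (d : ℕ) : Subalgebra ℝ ((Fin d → ℝ) → ℝ) where
  carrier := {f | ContDiff ℝ ∞ f}
  mul_mem' {f g} hf hg := by
    change ContDiff ℝ ∞ fun x => f x * g x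
    exact ContDiff.mul hf hg
  add_mem' {f g} hf hg := by
    change ContDiff ℝ ∞ fun x => f x + g x
    exact ContDiff.add hf hg
  algebraMap_mem' c := by
    change ContDiff ℝ ∞ fun _ => c
    exact contDiff_const

namespace smoothFunctions

variable {d : ℕ}

theorem mem_iff {f : (Fin d → ℝ) → ℝ} : f ∈ smoothFunctions d ↔ ContDiff ℝ ∞ f := Iff.rfl

theorem contDiff (f : smoothFunctions d) : ContDiff ℝ ∞ (f : (Fin d → ℝ) → ℝ) := mem_iff.1 f.2

theorem differentiable (f : smoothFunctions d) : Differentiable ℝ (f : (Fin d → ℝ) → ℝ) :=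
  (contDiff f).differentiable (by simp)

theorem contDiff_fderiv_apply {f : (Fin d → ℝ) → ℝ} (hf : ContDiff ℝ ∞ f) (v : Fin d → ℝ) :
    ContDiff ℝ ∞ fun x => fderiv ℝ f x v :=
  (hf.fderiv_right (m := ∞) (by simp)).clm_apply contDiff_const

/-- The partial derivative `∂ⱼ` as a derivation. -/
def partialDeriv (j : Fin d) : RingDerivation (smoothFunctions d) :=
  Derivation.mk' (AddMonoidHom.toIntLinearMap
    { toFun := fun f => ⟨fun x => fderiv ℝ (f : (Fin d → ℝ) → ℝ) x (Pi.single j 1),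
        contDiff_fderiv_apply (contDiff f) _⟩
      map_zero' := by
        ext x
        change fderiv ℝ (fun _ => (0 : ℝ)) x (Pi.single j 1) = 0
        simp
      map_add' := fun f g => by
        ext x
        change fderiv ℝ ((f : (Fin d → ℝ) → ℝ) + (g : (Fin d → ℝ) → ℝ)) x (Pi.single j 1) = _
        rw [fderiv_add (differentiable f x) (differentiable g x)]
        rfl }) fun f g => by
    ext x
    change fderiv ℝ ((f : (Fin d → ℝ) → ℝ) * (g : (Fin d → ℝ) → ℝ)) x (Pi.single j 1) = _
    rw [fderiv_mul (differentiable f x) (differentiable g x)]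
    rfl

theorem partialDeriv_apply (j : Fin d) (f : smoothFunctions d) (x : Fin d → ℝ) :
    (partialDeriv j f : (Fin d → ℝ) → ℝ) x =
      fderiv ℝ (f : (Fin d → ℝ) → ℝ) x (Pi.single j 1) := rfl

theorem partialDeriv_comm (i j : Fin d) (f : smoothFunctions d) :
    partialDeriv i (partialDeriv j f) = partialDeriv j (partialDeriv i f) := by
  ext x
  have hd : DifferentiableAt ℝ (fderiv ℝ (f : (Fin d → ℝ) → ℝ)) x :=
    ((contDiff f).fderiv_right (m := ∞) (by simp)).differentiable (by simp) x
  have h : ∀ i j, (partialDeriv i (partialDeriv j f) : (Fin d → ℝ) → ℝ) x =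
      fderiv ℝ (fderiv ℝ (f : (Fin d → ℝ) → ℝ)) x (Pi.single i 1) (Pi.single j 1) := fun i j => by
    rw [partialDeriv_apply]
    change fderiv ℝ (fun y => fderiv ℝ (f : (Fin d → ℝ) → ℝ) y (Pi.single j 1)) x _ = _
    rw [fderiv_clm_apply hd (differentiableAt_const _)]
    simp
  rw [h, h]
  exact ((contDiff f).contDiffAt.isSymmSndFDerivAt minSmoothness_two_le_infty).eq _ _

theorem tsupport_partialDeriv_subset (j : Fin d) (f : smoothFunctions d) :
    tsupport (partialDeriv j f : (Fin d → ℝ) → ℝ) ⊆ tsupport (f : (Fin d → ℝ) → ℝ) :=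
  tsupport_fderiv_apply_subset ℝ _

/-- Iterated partial derivatives on smooth functions. -/
def iteratedPartial (I : List (Fin d)) : smoothFunctions d →+ smoothFunctions d :=
  I.foldr (fun i F => (partialDeriv i).toLinearMap.toAddMonoidHom.comp F) (AddMonoidHom.id _)

@[simp]
theorem iteratedPartial_nil (f : smoothFunctions d) : iteratedPartial [] f = f := rfl

@[simp]
theorem iteratedPartial_cons (i : Fin d) (I : List (Fin d)) (f : smoothFunctions d) :
    iteratedPartial (i :: I) f = partialDeriv i (iteratedPartial I f) := rfl

theorem coe_iteratedPartial (I : List (Fin d)) (f : smoothFunctions d) :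
    (iteratedPartial I f : (Fin d → ℝ) → ℝ) = iterPartial I f := by
  induction I with
  | nil => rfl
  | cons i I ih =>
    ext x
    rw [iteratedPartial_cons, partialDeriv_apply, ih]
    rfl

theorem iteratedPartial_perm {I J : List (Fin d)} (h : I.Perm J) (f : smoothFunctions d) :
    iteratedPartial I f = iteratedPartial J f := by
  induction h with
  | nil => rfl
  | cons i _ ih => simp [ih]
  | swap i j I => exact partialDeriv_comm _ _ _
  | trans _ _ h₁ h₂ => exact h₁.trans h₂

theorem iteratedPartial_partialDeriv (i : Fin d) (I : List (Fin d)) (f : smoothFunctions d) :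
    iteratedPartial I (partialDeriv i f) = partialDeriv i (iteratedPartial I f) := by
  induction I with
  | nil => rfl
  | cons j I ih => rw [iteratedPartial_cons, ih, partialDeriv_comm]; rfl

theorem tsupport_iteratedPartial_subset (I : List (Fin d)) (f : smoothFunctions d) :
    tsupport (iteratedPartial I f : (Fin d → ℝ) → ℝ) ⊆ tsupport (f : (Fin d → ℝ) → ℝ) := by
  induction I with
  | nil => rfl
  | cons i I ih => exact (tsupport_partialDeriv_subset _ _).trans ih

/-- The `i`-th coordinate function. -/
def coord (i : Fin d) : smoothFunctions d := ⟨fun x => x i, mem_iff.2 (contDiff_apply ℝ ℝ i)⟩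

theorem partialDeriv_coord (i j : Fin d) :
    partialDeriv i (coord j) = if i = j then 1 else 0 := by
  ext x
  rw [partialDeriv_apply]
  have : fderiv ℝ (coord j : (Fin d → ℝ) → ℝ) x = ContinuousLinearMap.proj j :=
    (ContinuousLinearMap.proj (R := ℝ) (φ := fun _ : Fin d => ℝ) j).hasFDerivAt.fderiv
  rw [this]
  split_ifs with h
  · subst h; simp
  · simp [Ne.symm h]

/-- Higher derivatives of a coordinate vanish, so at most one occurrence of `b` in `I` can fall on
it. As partial derivatives commute, each of the `I.count b` choices leaves the same derivative. -/
theorem iteratedPartial_coord_mul (b : Fin d) (I : List (Fin d)) (f : smoothFunctions d) :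
    iteratedPartial I (coord b * f) =
      coord b * iteratedPartial I f + I.count b • iteratedPartial (I.erase b) f := by
  induction I with
  | nil => simp
  | cons i I ih =>
    rw [iteratedPartial_cons, ih, map_add, Derivation.leibniz, partialDeriv_coord, map_nsmul,
      iteratedPartial_cons, smul_eq_mul, smul_eq_mul, add_assoc]
    congr 1
    by_cases h : i = b
    · subst h
      rw [if_pos rfl, mul_one, List.count_cons_self, List.erase_cons_head, add_smul, one_smul,
        add_comm]
      congr 1
      by_cases hi : i ∈ I
      · rw [← iteratedPartial_cons, iteratedPartial_perm (List.perm_cons_erase hi).symm]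
      · simp [List.count_eq_zero_of_not_mem hi]
    · rw [if_neg h, mul_zero, zero_add, List.count_cons_of_ne h,
        List.erase_cons_tail (by simpa using h)]
      rfl

end smoothFunctions

theorem iterPartial_congr {d : ℕ} {f g : (Fin d → ℝ) → ℝ} {y : Fin d → ℝ} (h : f =ᶠ[𝓝 y] g)
    (I : List (Fin d)) : iterPartial I f =ᶠ[𝓝 y] iterPartial I g := by
  induction I with
  | nil => exact h
  | cons i I ih =>
    filter_upwards [ih.fderiv (𝕜 := ℝ)] with z hz
    simp only [iterPartial, hz]

/-! ### Jacobian matrices of a chart and the Piola identity. -/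

namespace AdaptedChart

variable {k m : ℕ} {P : Fin k → (Fin (k + m) → ℝ) → ℝ} (Φ : AdaptedChart P)

theorem contDiffAt {x : Fin (k + m) → ℝ} (hx : x ∈ Φ.toChart.source) :
    ContDiffAt ℝ ∞ Φ.toChart x :=
  Φ.smooth.contDiffAt (Φ.toChart.open_source.mem_nhds hx)

theorem contDiffAt_symm {y : Fin (k + m) → ℝ} (hy : y ∈ Φ.toChart.target) :
    ContDiffAt ℝ ∞ Φ.toChart.symm y :=
  Φ.smooth_symm.contDiffAt (Φ.toChart.open_target.mem_nhds hy)

theorem hasFDerivAt {x : Fin (k + m) → ℝ} (hx : x ∈ Φ.toChart.source) :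
    HasFDerivAt Φ.toChart (fderiv ℝ Φ.toChart x) x :=
  ((Φ.contDiffAt hx).differentiableAt (by simp)).hasFDerivAt

theorem hasFDerivAt_symm {y : Fin (k + m) → ℝ} (hy : y ∈ Φ.toChart.target) :
    HasFDerivAt Φ.toChart.symm (fderiv ℝ Φ.toChart.symm y) y :=
  ((Φ.contDiffAt_symm hy).differentiableAt (by simp)).hasFDerivAt

theorem fderiv_comp_fderiv_symm {y : Fin (k + m) → ℝ} (hy : y ∈ Φ.toChart.target) :
    (fderiv ℝ Φ.toChart (Φ.toChart.symm y)).comp (fderiv ℝ Φ.toChart.symm y) =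
      ContinuousLinearMap.id ℝ _ := by
  have h := (Φ.hasFDerivAt (Φ.toChart.map_target hy)).comp y (Φ.hasFDerivAt_symm hy)
  refine h.unique ((hasFDerivAt_id y).congr_of_eventuallyEq ?_)
  filter_upwards [Φ.toChart.open_target.mem_nhds hy] with z hz
  exact Φ.toChart.right_inv hz

/-- The Jacobian matrix `∂x / ∂(u, v)`. -/
def jacobian (y : Fin (k + m) → ℝ) : Matrix (Fin (k + m)) (Fin (k + m)) ℝ :=
  Matrix.of fun p q => fderiv ℝ Φ.toChart.symm y (Pi.single q 1) p

/-- The Jacobian matrix `∂(u, v) / ∂x` at the point with coordinates `y`. -/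
def invJacobian (y : Fin (k + m) → ℝ) : Matrix (Fin (k + m)) (Fin (k + m)) ℝ :=
  Matrix.of fun i j => fderiv ℝ Φ.toChart (Φ.toChart.symm y) (Pi.single j 1) i

theorem jacobian_eq_toMatrix' (y : Fin (k + m) → ℝ) : Φ.jacobian y =
    LinearMap.toMatrix' (fderiv ℝ Φ.toChart.symm y : (Fin (k + m) → ℝ) →ₗ[ℝ] Fin (k + m) → ℝ) := by
  ext p q
  rw [LinearMap.toMatrix'_apply]; rfl

theorem det_jacobian (y : Fin (k + m) → ℝ) :
    (Φ.jacobian y).det = (fderiv ℝ Φ.toChart.symm y).det := by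
  rw [jacobian_eq_toMatrix', LinearMap.det_toMatrix']

theorem invJacobian_mul_jacobian {y : Fin (k + m) → ℝ} (hy : y ∈ Φ.toChart.target) :
    Φ.invJacobian y * Φ.jacobian y = 1 := by
  have h1 : Φ.invJacobian y = LinearMap.toMatrix' (fderiv ℝ Φ.toChart (Φ.toChart.symm y) :
      (Fin (k + m) → ℝ) →ₗ[ℝ] Fin (k + m) → ℝ) := by
    ext p q
    rw [LinearMap.toMatrix'_apply]; rfl
  rw [h1, jacobian_eq_toMatrix', ← LinearMap.toMatrix'_comp, ← LinearMap.toMatrix'_id]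
  exact congrArg (fun L : (Fin (k + m) → ℝ) →L[ℝ] Fin (k + m) → ℝ =>
    LinearMap.toMatrix' (L : (Fin (k + m) → ℝ) →ₗ[ℝ] Fin (k + m) → ℝ))
    (Φ.fderiv_comp_fderiv_symm hy)

theorem jacobian_mul_invJacobian {y : Fin (k + m) → ℝ} (hy : y ∈ Φ.toChart.target) :
    Φ.jacobian y * Φ.invJacobian y = 1 :=
  mul_eq_one_comm.1 (Φ.invJacobian_mul_jacobian hy)

theorem contDiffAt_jacobian {y : Fin (k + m) → ℝ} (hy : y ∈ Φ.toChart.target)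
    (p q : Fin (k + m)) : ContDiffAt ℝ ∞ (fun z => Φ.jacobian z p q) y :=
  contDiffAt_pi.1 (((Φ.contDiffAt_symm hy).fderiv_right (m := ∞) (by simp)).clm_apply
    contDiffAt_const) p

theorem contDiffAt_invJacobian {y : Fin (k + m) → ℝ} (hy : y ∈ Φ.toChart.target)
    (i j : Fin (k + m)) : ContDiffAt ℝ ∞ (fun z => Φ.invJacobian z i j) y :=
  contDiffAt_pi.1 ((((Φ.contDiffAt (Φ.toChart.map_target hy)).fderiv_right (m := ∞) (by simp)).comp y
    (Φ.contDiffAt_symm hy)).clm_apply contDiffAt_const) i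

theorem differentiableAt_jacobian {y : Fin (k + m) → ℝ} (hy : y ∈ Φ.toChart.target)
    (p q : Fin (k + m)) : DifferentiableAt ℝ (fun z => Φ.jacobian z p q) y :=
  (Φ.contDiffAt_jacobian hy p q).differentiableAt (by simp)

theorem differentiableAt_invJacobian {y : Fin (k + m) → ℝ} (hy : y ∈ Φ.toChart.target)
    (i j : Fin (k + m)) : DifferentiableAt ℝ (fun z => Φ.invJacobian z i j) y :=
  (Φ.contDiffAt_invJacobian hy i j).differentiableAt (by simp)

theorem contDiffAt_det_jacobian {y : Fin (k + m) → ℝ} (hy : y ∈ Φ.toChart.target) :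
    ContDiffAt ℝ ∞ (fun z => (Φ.jacobian z).det) y := by
  simp only [Matrix.det_apply']
  exact ContDiffAt.sum fun s _ => contDiffAt_const.mul
    (contDiffAt_prod fun i _ => Φ.contDiffAt_jacobian hy _ _)

theorem fderiv_jacobian_symm {y : Fin (k + m) → ℝ} (hy : y ∈ Φ.toChart.target)
    (p q i : Fin (k + m)) :
    fderiv ℝ (fun z => Φ.jacobian z p q) y (Pi.single i 1) =
      fderiv ℝ (fun z => Φ.jacobian z p i) y (Pi.single q 1) := by
  have hd : DifferentiableAt ℝ (fderiv ℝ Φ.toChart.symm) y :=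
    ((Φ.contDiffAt_symm hy).fderiv_right (m := ∞) (by simp)).differentiableAt (by simp)
  have h : ∀ q i, fderiv ℝ (fun z => Φ.jacobian z p q) y (Pi.single i 1) =
      fderiv ℝ (fderiv ℝ Φ.toChart.symm) y (Pi.single i 1) (Pi.single q 1) p := fun q i => by
    have h1 : HasFDerivAt (fun z => fderiv ℝ Φ.toChart.symm z (Pi.single q 1))
        ((fderiv ℝ (fderiv ℝ Φ.toChart.symm) y).flip (Pi.single q 1)) y :=
      (hd.hasFDerivAt.clm_apply (hasFDerivAt_const _ _)).congr_fderiv (by ext; simp)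
    exact congrArg (· (Pi.single i 1)) (hasFDerivAt_pi'.1 h1 p).fderiv
  rw [h, h, ((Φ.contDiffAt_symm hy).isSymmSndFDerivAt minSmoothness_two_le_infty).eq]

/-- The Piola identity: the rows of `det (∂x/∂y) (∂y/∂x)` are free of divergence. -/
theorem sum_fderiv_det_mul_invJacobian {y : Fin (k + m) → ℝ} (hy : y ∈ Φ.toChart.target)
    (j : Fin (k + m)) :
    ∑ i, fderiv ℝ (fun z => (Φ.jacobian z).det * Φ.invJacobian z i j) y (Pi.single i 1) = 0 := by
  set A := Φ.jacobian y with hA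
  set B := Φ.invJacobian y with hB
  set dA : Fin (k + m) → Fin (k + m) → Fin (k + m) → ℝ :=
    fun i p q => fderiv ℝ (fun z => Φ.jacobian z p q) y (Pi.single i 1) with hdA
  have hBA : B * A = 1 := Φ.invJacobian_mul_jacobian hy
  have hadj : A.adjugate = A.det • B := by
    have := congrArg (B * ·) (Matrix.mul_adjugate A)
    simpa [← mul_assoc, hBA] using this
  have hdet : HasFDerivAt (fun z => (Φ.jacobian z).det) (∑ p, ∑ q, A.adjugate q p •
      fderiv ℝ (fun z => Φ.jacobian z p q) y) y :=
    HasFDerivAt.matrix_det fun p q => (Φ.differentiableAt_jacobian hy p q).hasFDerivAt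
  -- The derivative of an inverse matrix, `-B (dA) B`, obtained by differentiating `A B = 1` near
  -- `y` and multiplying by `B` on the left.
  have hdB : ∀ i q, fderiv ℝ (fun z => Φ.invJacobian z q j) y (Pi.single i 1) =
      -∑ p, ∑ r, B q p * dA i p r * B r j := by
    intro i q
    have h1 : ∀ p, ∑ r, (A p r * fderiv ℝ (fun z => Φ.invJacobian z r j) y (Pi.single i 1) +
        B r j * dA i p r) = 0 := fun p => by
      have h2 : HasFDerivAt (fun z => ∑ r, Φ.jacobian z p r * Φ.invJacobian z r j)
          (∑ r, (A p r • fderiv ℝ (fun z => Φ.invJacobian z r j) y +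
            B r j • fderiv ℝ (fun z => Φ.jacobian z p r) y)) y :=
        HasFDerivAt.fun_sum fun r _ => (Φ.differentiableAt_jacobian hy p r).hasFDerivAt.mul
          (Φ.differentiableAt_invJacobian hy r j).hasFDerivAt
      have h3 : HasFDerivAt (fun z => ∑ r, Φ.jacobian z p r * Φ.invJacobian z r j)
          (0 : (Fin (k + m) → ℝ) →L[ℝ] ℝ) y := by
        refine (hasFDerivAt_const ((1 : Matrix (Fin (k + m)) (Fin (k + m)) ℝ) p j) y)
          |>.congr_of_eventuallyEq ?_
        filter_upwards [Φ.toChart.open_target.mem_nhds hy] with z hz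
        rw [← Matrix.mul_apply, Φ.jacobian_mul_invJacobian hz]
      have := congrArg (· (Pi.single i 1)) (h2.unique h3)
      simpa using this
    have h4 : ∑ p, B q p * ∑ r, (A p r *
        fderiv ℝ (fun z => Φ.invJacobian z r j) y (Pi.single i 1) + B r j * dA i p r) = 0 := by
      simp [h1]
    have h5 : ∑ p, B q p * ∑ r, A p r *
        fderiv ℝ (fun z => Φ.invJacobian z r j) y (Pi.single i 1) =
        fderiv ℝ (fun z => Φ.invJacobian z q j) y (Pi.single i 1) := by
      have : ∀ r, ∑ p, B q p * A p r = (1 : Matrix _ _ ℝ) q r := fun r => by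
        rw [← Matrix.mul_apply, hBA]
      simp only [Finset.mul_sum]
      rw [Finset.sum_comm]
      simp only [← mul_assoc, ← Finset.sum_mul, this, Matrix.one_apply]
      simp
    simp only [Finset.sum_add_distrib, mul_add] at h4
    rw [h5] at h4
    rw [eq_neg_iff_add_eq_zero, ← h4]
    congr 1
    refine Finset.sum_congr rfl fun p _ => ?_
    rw [Finset.mul_sum]
    exact Finset.sum_congr rfl fun r _ => by ring
  have hterm : ∀ i, fderiv ℝ (fun z => (Φ.jacobian z).det * Φ.invJacobian z i j) y
      (Pi.single i 1) = A.det * ((∑ p, ∑ q, B q p * dA i p q) * B i j) -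
        A.det * ∑ p, ∑ r, B i p * dA i p r * B r j := fun i => by
    rw [(hdet.fun_mul (Φ.differentiableAt_invJacobian hy i j).hasFDerivAt).fderiv]
    simp only [add_apply, smul_apply, sum_apply, smul_eq_mul, hdB, hadj, Matrix.smul_apply]
    have : ∑ p, ∑ q, A.det * B q p * (fderiv ℝ (fun z => Φ.jacobian z p q) y) (Pi.single i 1) =
        A.det * ∑ p, ∑ q, B q p * dA i p q := by
      simp only [Finset.mul_sum, mul_assoc, hdA]
    rw [this]
    ring
  simp only [hterm, Finset.sum_sub_distrib, ← Finset.mul_sum, ← mul_sub]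
  -- The two sums agree after renaming the indices, because `dA i p q` is a second derivative of the
  -- inverse chart and is symmetric in `i` and `q`.
  have : ∑ i, (∑ p, ∑ q, B q p * dA i p q) * B i j = ∑ i, ∑ p, ∑ r, B i p * dA i p r * B r j := by
    simp only [Finset.sum_mul]
    calc ∑ i, ∑ p, ∑ q, B q p * dA i p q * B i j
        = ∑ i, ∑ q, ∑ p, B q p * dA i p q * B i j :=
          Finset.sum_congr rfl fun i _ => Finset.sum_comm
      _ = ∑ q, ∑ i, ∑ p, B q p * dA i p q * B i j := Finset.sum_comm
      _ = ∑ q, ∑ p, ∑ i, B q p * dA i p q * B i j :=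
          Finset.sum_congr rfl fun i _ => Finset.sum_comm
      _ = _ := Finset.sum_congr rfl fun q _ => Finset.sum_congr rfl fun p _ =>
          Finset.sum_congr rfl fun i _ => by
            rw [show dA i p q = dA q p i from Φ.fderiv_jacobian_symm hy p q i]
  rw [this, sub_self, mul_zero]

end AdaptedChart

/-! ### Compactly supported functions and their densities in a chart. -/

/-- The ideal of smooth functions with compact support in `U`. -/
def compactlySupportedIn {d : ℕ} (U : Set (Fin d → ℝ)) : Ideal (smoothFunctions d) where
  carrier := {f | HasCompactSupport (f : (Fin d → ℝ) → ℝ) ∧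
    tsupport (f : (Fin d → ℝ) → ℝ) ⊆ U}
  add_mem' {f g} hf hg := by
    refine ⟨?_, (tsupport_add (f : (Fin d → ℝ) → ℝ) g).trans (Set.union_subset hf.2 hg.2)⟩
    exact HasCompactSupport.add hf.1 hg.1
  zero_mem' := by
    change HasCompactSupport (fun _ => (0 : ℝ)) ∧ tsupport (fun _ => (0 : ℝ)) ⊆ U
    simp [HasCompactSupport, tsupport]
  smul_mem' c {f} hf :=
    ⟨HasCompactSupport.mul_left hf.1,
      (tsupport_mul_subset_right (f := (c : (Fin d → ℝ) → ℝ)) (g := f)).trans hf.2⟩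

namespace compactlySupportedIn

variable {d : ℕ} {U V : Set (Fin d → ℝ)} {f : smoothFunctions d}

theorem mono (h : U ⊆ V) (hf : f ∈ compactlySupportedIn U) : f ∈ compactlySupportedIn V :=
  ⟨hf.1, hf.2.trans h⟩

theorem of_tsupport_subset {g : smoothFunctions d} (hf : f ∈ compactlySupportedIn U)
    (h : tsupport (g : (Fin d → ℝ) → ℝ) ⊆ tsupport (f : (Fin d → ℝ) → ℝ)) :
    g ∈ compactlySupportedIn U :=
  ⟨hf.1.of_isClosed_subset (isClosed_tsupport _) h, h.trans hf.2⟩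

theorem partialDeriv_mem (hf : f ∈ compactlySupportedIn U) (j : Fin d) :
    smoothFunctions.partialDeriv j f ∈ compactlySupportedIn U :=
  of_tsupport_subset hf (smoothFunctions.tsupport_partialDeriv_subset j f)

theorem iteratedPartial_mem (hf : f ∈ compactlySupportedIn U) (I : List (Fin d)) :
    smoothFunctions.iteratedPartial I f ∈ compactlySupportedIn U :=
  of_tsupport_subset hf (smoothFunctions.tsupport_iteratedPartial_subset I f)

end compactlySupportedIn

theorem contDiff_of_contDiffAt_tsupport {E : Type*} [NormedAddCommGroup E] [NormedSpace ℝ E]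
    {f : E → ℝ} {n : ℕ∞ω} (h : ∀ x ∈ tsupport f, ContDiffAt ℝ n f x) : ContDiff ℝ n f := by
  refine contDiff_iff_contDiffAt.2 fun x => ?_
  by_cases hx : x ∈ tsupport f
  · exact h x hx
  · exact contDiffAt_const.congr_of_eventuallyEq (notMem_tsupport_iff_eventuallyEq.1 hx)

namespace AdaptedChart

variable {k m : ℕ} {P : Fin k → (Fin (k + m) → ℝ) → ℝ} (Φ : AdaptedChart P)

theorem density_of_mem (f : (Fin (k + m) → ℝ) → ℝ) {y : Fin (k + m) → ℝ}
    (hy : y ∈ Φ.toChart.target) :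
    Φ.density f y = f (Φ.toChart.symm y) * (Φ.jacobian y).det := by
  rw [density, Set.indicator_of_mem hy, det_jacobian]

theorem density_of_notMem (f : (Fin (k + m) → ℝ) → ℝ) {y : Fin (k + m) → ℝ}
    (hy : y ∉ Φ.toChart.target) : Φ.density f y = 0 :=
  Set.indicator_of_notMem hy _

/-- The image of the compact support is compact, hence closed in the whole space, so extension by
zero creates no singularity at the boundary of the chart. -/
theorem tsupport_density_subset {f : (Fin (k + m) → ℝ) → ℝ} (hc : HasCompactSupport f)
    (hs : tsupport f ⊆ Φ.toChart.source) :
    tsupport (Φ.density f) ⊆ Φ.toChart '' tsupport f := by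
  have hK : IsCompact (Φ.toChart '' tsupport f) :=
    hc.isCompact.image_of_continuousOn (Φ.toChart.continuousOn.mono hs)
  refine closure_minimal (fun y hy => ?_) hK.isClosed
  by_cases hyt : y ∈ Φ.toChart.target
  · rw [Function.mem_support, Φ.density_of_mem f hyt] at hy
    exact ⟨_, subset_tsupport _ (left_ne_zero_of_mul hy), Φ.toChart.right_inv hyt⟩
  · exact absurd (Φ.density_of_notMem f hyt) hy

theorem tsupport_density_subset_target {f : (Fin (k + m) → ℝ) → ℝ} (hc : HasCompactSupport f)
    (hs : tsupport f ⊆ Φ.toChart.source) : tsupport (Φ.density f) ⊆ Φ.toChart.target := by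
  refine (Φ.tsupport_density_subset hc hs).trans ?_
  rintro _ ⟨x, hx, rfl⟩
  exact Φ.toChart.map_source (hs hx)

theorem hasCompactSupport_density {f : (Fin (k + m) → ℝ) → ℝ} (hc : HasCompactSupport f)
    (hs : tsupport f ⊆ Φ.toChart.source) : HasCompactSupport (Φ.density f) :=
  (hc.isCompact.image_of_continuousOn (Φ.toChart.continuousOn.mono hs)).of_isClosed_subset
    (isClosed_tsupport _) (Φ.tsupport_density_subset hc hs)

theorem density_eventuallyEq (f : (Fin (k + m) → ℝ) → ℝ) {y : Fin (k + m) → ℝ}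
    (hy : y ∈ Φ.toChart.target) :
    Φ.density f =ᶠ[𝓝 y] fun z => f (Φ.toChart.symm z) * (Φ.jacobian z).det := by
  filter_upwards [Φ.toChart.open_target.mem_nhds hy] with z hz
  exact Φ.density_of_mem f hz

theorem contDiff_density {f : (Fin (k + m) → ℝ) → ℝ} (hf : ContDiff ℝ ∞ f)
    (hc : HasCompactSupport f) (hs : tsupport f ⊆ Φ.toChart.source) :
    ContDiff ℝ ∞ (Φ.density f) := by
  refine contDiff_of_contDiffAt_tsupport fun y hy => ?_
  have hyt := Φ.tsupport_density_subset_target hc hs hy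
  refine ContDiffAt.congr_of_eventuallyEq ?_ (Φ.density_eventuallyEq f hyt)
  exact (hf.contDiffAt.comp y (Φ.contDiffAt_symm hyt)).mul (Φ.contDiffAt_det_jacobian hyt)

/-- The density of a function supported in the chart, as a smooth function on `ℝⁿ`. -/
def smoothDensity (f : smoothFunctions (k + m))
    (hf : f ∈ compactlySupportedIn Φ.toChart.source) : smoothFunctions (k + m) :=
  ⟨Φ.density f, Φ.contDiff_density (smoothFunctions.contDiff f) hf.1 hf.2⟩

theorem smoothDensity_mem {f : smoothFunctions (k + m)}
    (hf : f ∈ compactlySupportedIn Φ.toChart.source) :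
    Φ.smoothDensity f hf ∈ compactlySupportedIn Φ.toChart.target :=
  ⟨Φ.hasCompactSupport_density hf.1 hf.2, Φ.tsupport_density_subset_target hf.1 hf.2⟩

/-- The product of a function `f` supported in the chart with `∂ᵢ` of the `j`-th coordinate. -/
def mulCoordDeriv (j i : Fin (k + m)) (f : smoothFunctions (k + m))
    (hf : f ∈ compactlySupportedIn Φ.toChart.source) : smoothFunctions (k + m) :=
  -- The factor is `∂yᵢ/∂xⱼ`: `i` numbers the chart coordinate and `j` the direction in `ℝⁿ`.
  ⟨fun x => (f : (Fin (k + m) → ℝ) → ℝ) x * fderiv ℝ Φ.toChart x (Pi.single j 1) i, by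
    refine smoothFunctions.mem_iff.2 (contDiff_of_contDiffAt_tsupport fun x hx => ?_)
    have hxs := hf.2 (tsupport_mul_subset_left hx)
    refine (smoothFunctions.contDiff f).contDiffAt.mul (contDiffAt_pi.1 ?_ i)
    exact ((Φ.contDiffAt hxs).fderiv_right (m := ∞) (by simp)).clm_apply contDiffAt_const⟩

theorem mulCoordDeriv_mem (j i : Fin (k + m)) {f : smoothFunctions (k + m)}
    (hf : f ∈ compactlySupportedIn Φ.toChart.source) :
    Φ.mulCoordDeriv j i f hf ∈ compactlySupportedIn Φ.toChart.source :=
  compactlySupportedIn.of_tsupport_subset hf tsupport_mul_subset_left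

theorem fderiv_eq_zero_of_notMem_tsupport {d : ℕ} {f : (Fin d → ℝ) → ℝ} {x : Fin d → ℝ}
    (hx : x ∉ tsupport f) (v : Fin d → ℝ) : fderiv ℝ f x v = 0 := by
  have h : fderiv ℝ f x = 0 := image_eq_zero_of_notMem_tsupport
    fun h => hx (tsupport_fderiv_subset ℝ h)
  rw [h]; rfl

/-- The chain rule in coordinates, in divergence form. -/
theorem smoothDensity_partialDeriv (j : Fin (k + m)) {f : smoothFunctions (k + m)}
    (hf : f ∈ compactlySupportedIn Φ.toChart.source) :
    Φ.smoothDensity (smoothFunctions.partialDeriv j f)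
        (compactlySupportedIn.partialDeriv_mem hf j) =
      ∑ i, smoothFunctions.partialDeriv i
        (Φ.smoothDensity (Φ.mulCoordDeriv j i f hf) (Φ.mulCoordDeriv_mem j i hf)) := by
  ext y
  have hsum : ∀ F : Fin (k + m) → smoothFunctions (k + m),
      ((∑ i, F i : smoothFunctions (k + m)) : (Fin (k + m) → ℝ) → ℝ) y =
        ∑ i, (F i : (Fin (k + m) → ℝ) → ℝ) y := fun F => by
    rw [AddSubmonoidClass.coe_finsetSum, Finset.sum_apply]
  rw [hsum]
  simp only [smoothFunctions.partialDeriv_apply]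
  by_cases hy : y ∈ Φ.toChart.target
  · have h1 : ∀ i, fderiv ℝ (Φ.smoothDensity (Φ.mulCoordDeriv j i f hf)
        (Φ.mulCoordDeriv_mem j i hf) : (Fin (k + m) → ℝ) → ℝ) y (Pi.single i 1) =
        (f : (Fin (k + m) → ℝ) → ℝ) (Φ.toChart.symm y) * fderiv ℝ (fun z => (Φ.jacobian z).det *
          Φ.invJacobian z i j) y (Pi.single i 1) +
        (Φ.jacobian y).det * Φ.invJacobian y i j *
          fderiv ℝ (fun z => (f : (Fin (k + m) → ℝ) → ℝ) (Φ.toChart.symm z)) y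
            (Pi.single i 1) := fun i => by
      have h2 : (Φ.smoothDensity (Φ.mulCoordDeriv j i f hf)
          (Φ.mulCoordDeriv_mem j i hf) : (Fin (k + m) → ℝ) → ℝ) =ᶠ[𝓝 y]
          fun z => (f : (Fin (k + m) → ℝ) → ℝ) (Φ.toChart.symm z) *
            ((Φ.jacobian z).det * Φ.invJacobian z i j) := by
        filter_upwards [Φ.density_eventuallyEq (Φ.mulCoordDeriv j i f hf : _ → ℝ) hy] with z hz
        refine hz.trans ?_
        change _ * Φ.invJacobian z i j * _ = _
        ring
      rw [h2.fderiv_eq, fderiv_fun_mul]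
      · simp
      · exact ((smoothFunctions.differentiable f) _).comp y
          ((Φ.contDiffAt_symm hy).differentiableAt (by simp))
      · exact ((Φ.contDiffAt_det_jacobian hy).differentiableAt (by simp)).mul
          (Φ.differentiableAt_invJacobian hy i j)
    -- Summed over `i`, the terms in which the derivative falls on the Jacobian factor vanish by the
    -- Piola identity; what remains is the chain rule for `f`.
    simp only [h1, Finset.sum_add_distrib, ← Finset.mul_sum,
      Φ.sum_fderiv_det_mul_invJacobian hy j, mul_zero, zero_add, mul_assoc]
    have h3 : ∑ i, Φ.invJacobian y i j *
        fderiv ℝ (fun z => (f : (Fin (k + m) → ℝ) → ℝ) (Φ.toChart.symm z)) y (Pi.single i 1) =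
        fderiv ℝ (f : (Fin (k + m) → ℝ) → ℝ) (Φ.toChart.symm y) (Pi.single j 1) := by
      have h4 : fderiv ℝ (fun z => (f : (Fin (k + m) → ℝ) → ℝ) (Φ.toChart.symm z)) y =
          (fderiv ℝ (f : (Fin (k + m) → ℝ) → ℝ) (Φ.toChart.symm y)).comp
            (fderiv ℝ Φ.toChart.symm y) :=
        ((smoothFunctions.differentiable f _).hasFDerivAt.comp y (Φ.hasFDerivAt_symm hy)).fderiv
      have h5 : ∀ i, fderiv ℝ Φ.toChart.symm y (Pi.single i 1) =
          ∑ p, Φ.jacobian y p i • Pi.single p (1 : ℝ) := fun i => by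
        rw [pi_eq_sum_univ' (fderiv ℝ Φ.toChart.symm y (Pi.single i 1))]
        refine Finset.sum_congr rfl fun p _ => ?_
        congr 1
      simp only [h4, ContinuousLinearMap.comp_apply, h5, map_sum, map_smul, smul_eq_mul,
        Finset.mul_sum]
      rw [Finset.sum_comm]
      have h6 : ∀ p, ∑ i, Φ.invJacobian y i j * (Φ.jacobian y p i *
          fderiv ℝ (f : (Fin (k + m) → ℝ) → ℝ) (Φ.toChart.symm y) (Pi.single p 1)) =
          (1 : Matrix (Fin (k + m)) (Fin (k + m)) ℝ) p j *
            fderiv ℝ (f : (Fin (k + m) → ℝ) → ℝ) (Φ.toChart.symm y) (Pi.single p 1) := fun p => by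
        rw [← Φ.jacobian_mul_invJacobian hy, Matrix.mul_apply, Finset.sum_mul]
        exact Finset.sum_congr rfl fun i _ => by ring
      simp [h6, Matrix.one_apply]
    rw [h3]
    exact (Φ.density_of_mem _ hy).trans (mul_comm _ _)
  · have h1 : ∀ i, fderiv ℝ (Φ.smoothDensity (Φ.mulCoordDeriv j i f hf)
        (Φ.mulCoordDeriv_mem j i hf) : (Fin (k + m) → ℝ) → ℝ) y (Pi.single i 1) = 0 := fun i =>
      fderiv_eq_zero_of_notMem_tsupport
        (fun h => hy ((Φ.smoothDensity_mem (Φ.mulCoordDeriv_mem j i hf)).2 h)) _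
    simp only [h1, Finset.sum_const_zero]
    exact Φ.density_of_notMem _ hy

end AdaptedChart

/-! ### Alternating forms, the slice `u = 0`, and integration by parts. -/

theorem AlternatingMap.apply_eq_mul_det {m : ℕ} (g : (Fin m → ℝ) [⋀^Fin m]→ₗ[ℝ] ℝ)
    (c : Fin m → Fin m → ℝ) :
    g c = g (fun l => Pi.single l 1) * (Matrix.of c).det := by
  conv_lhs => rw [g.eq_smul_basis_det (Pi.basisFun ℝ (Fin m))]
  rw [AlternatingMap.smul_apply, Pi.basisFun_det_apply, smul_eq_mul]
  congr 2
  ext l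
  simp

theorem ContinuousAlternatingMap.comp_apply_eq_mul_det {m : ℕ} {E : Type*} [NormedAddCommGroup E]
    [NormedSpace ℝ E] (η : E [⋀^Fin m]→L[ℝ] ℝ) (L : (Fin m → ℝ) →L[ℝ] E)
    (c : Fin m → Fin m → ℝ) :
    η (fun l => L (c l)) = η (fun l => L (Pi.single l 1)) * (Matrix.of c).det :=
  AlternatingMap.apply_eq_mul_det (η.compContinuousLinearMap L).toAlternatingMap c

/-- The embedding `v ↦ (0, v)`. -/
def appendZero (k m : ℕ) : (Fin m → ℝ) →L[ℝ] Fin (k + m) → ℝ :=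
  LinearMap.toContinuousLinearMap
    { toFun := fun v => Fin.append (0 : Fin k → ℝ) v
      map_add' := fun v w => by
        ext i
        refine Fin.addCases (fun i => ?_) (fun i => ?_) i <;> simp
      map_smul' := fun c v => by
        ext i
        refine Fin.addCases (fun i => ?_) (fun i => ?_) i <;> simp }

section appendZero

variable {k m : ℕ}

theorem appendZero_apply (v : Fin m → ℝ) : appendZero k m v = Fin.append (0 : Fin k → ℝ) v := rfl

@[simp]
theorem appendZero_castAdd (v : Fin m → ℝ) (i : Fin k) :
    appendZero k m v (Fin.castAdd m i) = 0 := by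
  simp [appendZero_apply]

@[simp]
theorem appendZero_natAdd (v : Fin m → ℝ) (l : Fin m) :
    appendZero k m v (Fin.natAdd k l) = v l := by
  simp [appendZero_apply]

theorem appendZero_single (l : Fin m) :
    appendZero k m (Pi.single l 1) = Pi.single (Fin.natAdd k l) 1 := by
  ext i
  refine Fin.addCases (fun i => ?_) (fun i => ?_) i
  · rw [appendZero_castAdd, Pi.single_eq_of_ne]
    intro h
    have := congrArg Fin.val h
    simp at this
    omega
  · rw [appendZero_natAdd]
    by_cases h : i = l
    · subst h; simp
    · rw [Pi.single_eq_of_ne h, Pi.single_eq_of_ne]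
      exact fun h' => h (Fin.natAdd_injective _ _ h')

theorem eq_appendZero {y : Fin (k + m) → ℝ} (hy : ∀ i : Fin k, y (Fin.castAdd m i) = 0) :
    y = appendZero k m fun l => y (Fin.natAdd k l) := by
  ext i
  refine Fin.addCases (fun i => ?_) (fun i => ?_) i <;> simp [hy]

theorem appendZero_injective : Function.Injective (appendZero k m) := fun v w h => by
  ext l
  have := congrFun h (Fin.natAdd k l)
  simpa using this

theorem isClosedEmbedding_appendZero : Topology.IsClosedEmbedding (appendZero k m) :=
  LinearMap.isClosedEmbedding_of_injective (f := (appendZero k m).toLinearMap)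
    (LinearMap.ker_eq_bot.2 appendZero_injective)

end appendZero

theorem integral_fderiv_apply_eq_zero {m : ℕ} {h : (Fin m → ℝ) → ℝ} (hh : ContDiff ℝ 1 h)
    (hc : HasCompactSupport h) (w : Fin m → ℝ) : ∫ v, fderiv ℝ h v w = 0 := by
  have hi : MeasureTheory.Integrable fun v => fderiv ℝ h v w :=
    ((hh.continuous_fderiv (by simp)).clm_apply continuous_const).integrable_of_hasCompactSupport
      (hc.fderiv_apply ℝ w)
  -- Integration by parts against the constant function `1`.
  have := integral_smul_fderiv_eq_neg_fderiv_smul_of_integrable (f := fun _ => (1 : ℝ)) (g := h)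
    (v := w) (μ := MeasureTheory.volume) (by simp) (by simpa using hi)
    (by simpa using hh.continuous.integrable_of_hasCompactSupport hc)
    (by simp) (fun x _ => hh.differentiable (by simp) x)
  simpa using this

/-! ### Orientation signs and integrals over the slice. -/

namespace AdaptedChart

variable {k m : ℕ} {P : Fin k → (Fin (k + m) → ℝ) → ℝ} (Φ : AdaptedChart P)
  {Ω : (Fin (k + m) → ℝ) → (Fin (k + m) → ℝ) [⋀^Fin m]→L[ℝ] ℝ}

theorem symm_mem_zeroSurface {v : Fin m → ℝ} (hv : appendZero k m v ∈ Φ.toChart.target) :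
    Φ.toChart.symm (appendZero k m v) ∈ zeroSurface P := fun i => by
  rw [← Φ.coord_eq _ (Φ.toChart.map_target hv), Φ.toChart.right_inv hv, appendZero_castAdd]

theorem fderiv_castAdd {x : Fin (k + m) → ℝ} (hx : x ∈ Φ.toChart.source) (i : Fin k)
    (w : Fin (k + m) → ℝ) :
    fderiv ℝ Φ.toChart x w (Fin.castAdd m i) = fderiv ℝ (P i) x w := by
  have h1 : HasFDerivAt (fun z => Φ.toChart z (Fin.castAdd m i))
      ((ContinuousLinearMap.proj (Fin.castAdd m i)).comp (fderiv ℝ Φ.toChart x)) x :=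
    hasFDerivAt_pi'.1 (Φ.hasFDerivAt hx) _
  have h2 : P i =ᶠ[𝓝 x] fun z => Φ.toChart z (Fin.castAdd m i) := by
    filter_upwards [Φ.toChart.open_source.mem_nhds hx] with z hz
    exact (Φ.coord_eq z hz i).symm
  rw [h2.fderiv_eq, h1.fderiv]
  rfl

theorem fderiv_symm_comp_fderiv {x : Fin (k + m) → ℝ} (hx : x ∈ Φ.toChart.source)
    (w : Fin (k + m) → ℝ) :
    fderiv ℝ Φ.toChart.symm (Φ.toChart x) (fderiv ℝ Φ.toChart x w) = w := by
  have h := (Φ.hasFDerivAt_symm (Φ.toChart.map_source hx)).comp x (Φ.hasFDerivAt hx)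
  have h2 := h.unique ((hasFDerivAt_id x).congr_of_eventuallyEq (by
    filter_upwards [Φ.toChart.open_source.mem_nhds hx] with z hz
    exact Φ.toChart.left_inv hz))
  exact congrArg (· w) h2

/-- The orienting form does not vanish on the coordinate frame of the surface. -/
theorem orientation_frame_ne_zero (hΩ : OrientsSurface P Ω) {v : Fin m → ℝ}
    (hv : appendZero k m v ∈ Φ.toChart.target) :
    Ω (Φ.toChart.symm (appendZero k m v)) (fun l : Fin m =>
      fderiv ℝ Φ.toChart.symm (appendZero k m v) (Pi.single (Fin.natAdd k l) 1)) ≠ 0 := by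
  obtain ⟨w, hw, hne⟩ := hΩ.2 _ (Φ.symm_mem_zeroSurface hv)
  set x := Φ.toChart.symm (appendZero k m v) with hx
  have hxs : x ∈ Φ.toChart.source := Φ.toChart.map_target hv
  have hxy : Φ.toChart x = appendZero k m v := Φ.toChart.right_inv hv
  set L := (fderiv ℝ Φ.toChart.symm (appendZero k m v)).comp (appendZero k m) with hL
  -- Every tangent vector is a combination of the coordinate frame, so the value of the form on `w`
  -- is a multiple of its value on that frame.
  have hwL : ∀ l, w l = L fun j => fderiv ℝ Φ.toChart x (w l) (Fin.natAdd k j) := fun l => by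
    rw [hL, ContinuousLinearMap.comp_apply, ← eq_appendZero, ← hxy, Φ.fderiv_symm_comp_fderiv hxs]
    intro i
    rw [Φ.fderiv_castAdd hxs, hw]
  intro h0
  refine hne ?_
  rw [funext hwL, ContinuousAlternatingMap.comp_apply_eq_mul_det]
  simp only [hL, ContinuousLinearMap.comp_apply, appendZero_single]
  rw [h0, zero_mul]

/-- A continuous function without zeros has locally constant sign. The orientation factor therefore
passes through derivatives along the surface. -/
theorem frameSign_eventuallyEq (hΩ : OrientsSurface P Ω) {v : Fin m → ℝ}
    (hv : appendZero k m v ∈ Φ.toChart.target) :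
    ∀ᶠ v' in 𝓝 v, Φ.frameSign Ω (appendZero k m v') = Φ.frameSign Ω (appendZero k m v) := by
  have hN : IsOpen (appendZero k m ⁻¹' Φ.toChart.target) :=
    Φ.toChart.open_target.preimage (appendZero k m).continuous
  have hcont : ContinuousOn (fun v' => Ω (Φ.toChart.symm (appendZero k m v')) (fun l : Fin m =>
      fderiv ℝ Φ.toChart.symm (appendZero k m v') (Pi.single (Fin.natAdd k l) 1)))
      (appendZero k m ⁻¹' Φ.toChart.target) := by
    refine ContinuousOn.eval ?_ ?_
    · exact hΩ.1.comp (Φ.toChart.continuousOn_symm.comp (appendZero k m).continuous.continuousOn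
        fun _ h => h) fun _ h => Φ.symm_mem_zeroSurface h
    · refine continuousOn_pi.2 fun l => ?_
      refine ContinuousOn.clm_apply ?_ continuousOn_const
      exact (Φ.smooth_symm.continuousOn_fderiv_of_isOpen Φ.toChart.open_target (by simp)).comp
        (appendZero k m).continuous.continuousOn fun _ h => h
  have hat := hcont.continuousAt (hN.mem_nhds hv)
  have hne := Φ.orientation_frame_ne_zero hΩ hv
  rcases hne.lt_or_gt with h | h
  · filter_upwards [hat.eventually_lt_const h] with v' hv'
    rw [frameSign, frameSign, Real.sign_of_neg hv', Real.sign_of_neg h]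
  · filter_upwards [hat.eventually_const_lt h] with v' hv'
    rw [frameSign, frameSign, Real.sign_of_pos hv', Real.sign_of_pos h]

/-- The restriction of a function to the surface `u = 0`, multiplied by the orientation sign. -/
def signedSlice (Ω : (Fin (k + m) → ℝ) → (Fin (k + m) → ℝ) [⋀^Fin m]→L[ℝ] ℝ)
    (h : (Fin (k + m) → ℝ) → ℝ) (v : Fin m → ℝ) : ℝ :=
  Φ.frameSign Ω (appendZero k m v) * h (appendZero k m v)

variable {h : smoothFunctions (k + m)}

/-- Outside the target the sign has no geometric meaning, but there `h` vanishes nearby. -/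
theorem signedSlice_eventuallyEq (hΩ : OrientsSurface P Ω)
    (hh : h ∈ compactlySupportedIn Φ.toChart.target) (v : Fin m → ℝ) :
    Φ.signedSlice Ω h =ᶠ[𝓝 v] fun v' =>
      Φ.frameSign Ω (appendZero k m v) * (h : _ → ℝ) (appendZero k m v') := by
  by_cases hv : appendZero k m v ∈ Φ.toChart.target
  · filter_upwards [Φ.frameSign_eventuallyEq hΩ hv] with v' hv'
    rw [signedSlice, hv']
  · have h0 : ∀ᶠ v' in 𝓝 v, (h : _ → ℝ) (appendZero k m v') = 0 :=
      (appendZero k m).continuous.continuousAt.eventually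
        (notMem_tsupport_iff_eventuallyEq.1 fun h => hv (hh.2 h))
    filter_upwards [h0] with v' hv'
    simp only [signedSlice, hv', mul_zero]

theorem contDiff_signedSlice (hΩ : OrientsSurface P Ω)
    (hh : h ∈ compactlySupportedIn Φ.toChart.target) : ContDiff ℝ ∞ (Φ.signedSlice Ω h) :=
  contDiff_iff_contDiffAt.2 fun v => ContDiffAt.congr_of_eventuallyEq
    (contDiffAt_const.mul
      ((smoothFunctions.contDiff h).comp (appendZero k m).contDiff).contDiffAt)
    (Φ.signedSlice_eventuallyEq hΩ hh v)

theorem hasCompactSupport_signedSlice (hh : h ∈ compactlySupportedIn Φ.toChart.target) :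
    HasCompactSupport (Φ.signedSlice Ω h) :=
  HasCompactSupport.mul_left (f := fun v => Φ.frameSign Ω (appendZero k m v))
    (hh.1.comp_isClosedEmbedding isClosedEmbedding_appendZero)

theorem integrable_signedSlice (hΩ : OrientsSurface P Ω)
    (hh : h ∈ compactlySupportedIn Φ.toChart.target) :
    MeasureTheory.Integrable (Φ.signedSlice Ω h) :=
  (Φ.contDiff_signedSlice hΩ hh).continuous.integrable_of_hasCompactSupport
    (Φ.hasCompactSupport_signedSlice hh)

theorem fderiv_signedSlice (hΩ : OrientsSurface P Ω)
    (hh : h ∈ compactlySupportedIn Φ.toChart.target) (l : Fin m) (v : Fin m → ℝ) :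
    fderiv ℝ (Φ.signedSlice Ω h) v (Pi.single l 1) =
      Φ.signedSlice Ω (smoothFunctions.partialDeriv (Fin.natAdd k l) h) v := by
  have h1 : HasFDerivAt (fun v' => (h : _ → ℝ) (appendZero k m v'))
      ((fderiv ℝ (h : _ → ℝ) (appendZero k m v)).comp (appendZero k m)) v :=
    (smoothFunctions.differentiable h _).hasFDerivAt.comp v (appendZero k m).hasFDerivAt
  rw [(Φ.signedSlice_eventuallyEq hΩ hh v).fderiv_eq, (h1.const_mul _).fderiv]
  simp only [smul_apply, ContinuousLinearMap.comp_apply, appendZero_single, smul_eq_mul]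
  rfl

/-- The derivative is tangential, hence commutes with restriction to the slice and integrates to
zero by compact support. -/
theorem integral_signedSlice_partialDeriv_natAdd (hΩ : OrientsSurface P Ω)
    (hh : h ∈ compactlySupportedIn Φ.toChart.target) (l : Fin m) :
    ∫ v, Φ.signedSlice Ω (smoothFunctions.partialDeriv (Fin.natAdd k l) h) v = 0 := by
  rw [← integral_fderiv_apply_eq_zero ((Φ.contDiff_signedSlice hΩ hh).of_le (by simp))
    (Φ.hasCompactSupport_signedSlice hh) (Pi.single l 1)]
  simp only [Φ.fderiv_signedSlice hΩ hh]

end AdaptedChart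

/-! ### The local functionals satisfy the product rule and the chain rule. -/

namespace AdaptedChart

variable {k m : ℕ} {P : Fin k → (Fin (k + m) → ℝ) → ℝ} (Φ : AdaptedChart P)
  {Ω : (Fin (k + m) → ℝ) → (Fin (k + m) → ℝ) [⋀^Fin m]→L[ℝ] ℝ}

theorem localDelta_eq (I : List (Fin k)) {f : smoothFunctions (k + m)}
    (hf : f ∈ compactlySupportedIn Φ.toChart.source) :
    Φ.localDelta Ω I f = (-1) ^ I.length * ∫ v, Φ.signedSlice Ω
      (smoothFunctions.iteratedPartial (I.map (Fin.castAdd m)) (Φ.smoothDensity f hf)) v := by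
  rw [smoothFunctions.coe_iteratedPartial]
  rfl

theorem smoothDensity_add {f g : smoothFunctions (k + m)}
    (hf : f ∈ compactlySupportedIn Φ.toChart.source)
    (hg : g ∈ compactlySupportedIn Φ.toChart.source) :
    Φ.smoothDensity (f + g) (add_mem hf hg) = Φ.smoothDensity f hf + Φ.smoothDensity g hg := by
  ext y
  change Φ.density _ y = Φ.density _ y + Φ.density _ y
  by_cases hy : y ∈ Φ.toChart.target
  · simp only [Φ.density_of_mem _ hy]
    exact add_mul _ _ _
  · simp only [Φ.density_of_notMem _ hy, add_zero]

theorem signedSlice_add (f g : smoothFunctions (k + m)) :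
    Φ.signedSlice Ω (f + g : smoothFunctions (k + m)) = Φ.signedSlice Ω f + Φ.signedSlice Ω g := by
  ext v
  exact mul_add _ _ _

theorem localDelta_add (hΩ : OrientsSurface P Ω) (I : List (Fin k)) {f g : smoothFunctions (k + m)}
    (hf : f ∈ compactlySupportedIn Φ.toChart.source)
    (hg : g ∈ compactlySupportedIn Φ.toChart.source) :
    Φ.localDelta Ω I (f + g : smoothFunctions (k + m)) =
      Φ.localDelta Ω I f + Φ.localDelta Ω I g := by
  have h := fun {f} (hf : f ∈ compactlySupportedIn Φ.toChart.source) =>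
    Φ.integrable_signedSlice hΩ (compactlySupportedIn.iteratedPartial_mem
      (Φ.smoothDensity_mem hf) (I.map (Fin.castAdd m)))
  rw [Φ.localDelta_eq I (add_mem hf hg), Φ.localDelta_eq I hf, Φ.localDelta_eq I hg,
    smoothDensity_add, map_add, signedSlice_add, ← mul_add,
    ← MeasureTheory.integral_add (h hf) (h hg)]
  rfl

/-- The functional `δ_I(P)` on functions supported in a chart, as a homomorphism. -/
def localDeltaHom (hΩ : OrientsSurface P Ω) (I : List (Fin k)) :
    compactlySupportedIn Φ.toChart.source →+ ℝ :=
  AddMonoidHom.mk' (fun f => Φ.localDelta Ω I (f : smoothFunctions (k + m)))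
    fun f g => Φ.localDelta_add hΩ I f.2 g.2

theorem localDelta_perm {I J : List (Fin k)} (h : I.Perm J) {f : smoothFunctions (k + m)}
    (hf : f ∈ compactlySupportedIn Φ.toChart.source) :
    Φ.localDelta Ω I f = Φ.localDelta Ω J f := by
  rw [Φ.localDelta_eq I hf, Φ.localDelta_eq J hf, h.length_eq,
    smoothFunctions.iteratedPartial_perm (h.map _)]

/-- In the chart, multiplication by `P b` is multiplication by `u_b`, which is zero on the slice, so
only the terms that differentiate `u_b` survive. The minus sign comes from the loss of one
derivative in `(-1) ^ s`. -/
theorem localDelta_mul_coord (b : Fin k) (I : List (Fin k)) {f p : smoothFunctions (k + m)}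
    (hp : (p : _ → ℝ) = P b) (hf : f ∈ compactlySupportedIn Φ.toChart.source) :
    Φ.localDelta Ω I (p * f : smoothFunctions (k + m)) =
      -(I.count b * Φ.localDelta Ω (I.erase b) f) := by
  have h1 : Φ.smoothDensity (p * f) (Ideal.mul_mem_left _ _ hf) =
      smoothFunctions.coord (Fin.castAdd m b) * Φ.smoothDensity f hf := by
    ext y
    change Φ.density _ y = y (Fin.castAdd m b) * Φ.density _ y
    by_cases hy : y ∈ Φ.toChart.target
    · rw [Φ.density_of_mem _ hy, Φ.density_of_mem _ hy, ← mul_assoc]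
      congr 1
      change (p : _ → ℝ) (Φ.toChart.symm y) * (f : _ → ℝ) (Φ.toChart.symm y) = _
      rw [hp, ← Φ.coord_eq _ (Φ.toChart.map_target hy), Φ.toChart.right_inv hy]
    · simp only [Φ.density_of_notMem _ hy, mul_zero]
  have hinj : Function.Injective (Fin.castAdd m : Fin k → Fin (k + m)) :=
    Fin.castAdd_injective k m
  rw [Φ.localDelta_eq I (Ideal.mul_mem_left _ _ hf), Φ.localDelta_eq _ hf, h1,
    smoothFunctions.iteratedPartial_coord_mul, List.count_map_of_injective _ _ hinj,
    ← List.map_erase hinj]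
  have h2 : ∀ v, Φ.signedSlice Ω (smoothFunctions.coord (Fin.castAdd m b) *
      smoothFunctions.iteratedPartial (I.map (Fin.castAdd m)) (Φ.smoothDensity f hf) +
      I.count b • smoothFunctions.iteratedPartial ((I.erase b).map (Fin.castAdd m))
        (Φ.smoothDensity f hf) : smoothFunctions (k + m)) v = I.count b *
      Φ.signedSlice Ω (smoothFunctions.iteratedPartial ((I.erase b).map (Fin.castAdd m))
        (Φ.smoothDensity f hf)) v := fun v => by
    rw [signedSlice, signedSlice, nsmul_eq_mul]
    change _ * (appendZero k m v (Fin.castAdd m b) * _ + (I.count b : ℝ) * _) = _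
    rw [appendZero_castAdd]
    ring
  simp only [h2, MeasureTheory.integral_const_mul]
  by_cases hb : b ∈ I
  · rw [← List.length_erase_add_one hb, pow_succ]
    ring
  · simp [List.count_eq_zero_of_not_mem hb]

/-- The density of `∂ⱼ f` is a divergence. Its `v`-components integrate to zero, and each
`u_l`-component adds the index `l` to the list, with one more sign. -/
theorem localDelta_chain_rule (hΩ : OrientsSurface P Ω) (j : Fin (k + m)) (I : List (Fin k))
    {f : smoothFunctions (k + m)} {p : Fin k → smoothFunctions (k + m)}
    (hp : ∀ l, (p l : _ → ℝ) = P l) (hf : f ∈ compactlySupportedIn Φ.toChart.source) :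
    ∑ l, Φ.localDelta Ω (l :: I)
        (smoothFunctions.partialDeriv j (p l) * f : smoothFunctions (k + m)) =
      -Φ.localDelta Ω I (smoothFunctions.partialDeriv j f) := by
  have h1 : ∀ l, smoothFunctions.partialDeriv j (p l) * f =
      Φ.mulCoordDeriv j (Fin.castAdd m l) f hf := fun l => by
    ext x
    change fderiv ℝ (p l : _ → ℝ) x _ * (f : _ → ℝ) x = (f : _ → ℝ) x * _
    by_cases hx : x ∈ Φ.toChart.source
    · rw [Φ.fderiv_castAdd hx, hp, mul_comm]
    · have : (f : _ → ℝ) x = 0 := image_eq_zero_of_notMem_tsupport fun h => hx (hf.2 h)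
      rw [this, mul_zero, zero_mul]
  have hmem := fun i => compactlySupportedIn.iteratedPartial_mem
    (Φ.smoothDensity_mem (Φ.mulCoordDeriv_mem j i hf)) (I.map (Fin.castAdd m))
  have h2 : ∫ v, Φ.signedSlice Ω (smoothFunctions.iteratedPartial (I.map (Fin.castAdd m))
      (Φ.smoothDensity _ (compactlySupportedIn.partialDeriv_mem hf j))) v =
      ∑ i, ∫ v, Φ.signedSlice Ω (smoothFunctions.partialDeriv i
        (smoothFunctions.iteratedPartial (I.map (Fin.castAdd m))
          (Φ.smoothDensity _ (Φ.mulCoordDeriv_mem j i hf)))) v := by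
    rw [← MeasureTheory.integral_finsetSum _ fun i _ => Φ.integrable_signedSlice hΩ
      (compactlySupportedIn.partialDeriv_mem (hmem i) i)]
    congr 1
    ext v
    rw [smoothDensity_partialDeriv, map_sum]
    simp only [smoothFunctions.iteratedPartial_partialDeriv, signedSlice, ← Finset.mul_sum]
    rw [AddSubmonoidClass.coe_finsetSum, Finset.sum_apply]
  rw [Φ.localDelta_eq I (compactlySupportedIn.partialDeriv_mem hf j), h2, Fin.sum_univ_add,
    Finset.sum_eq_zero (s := Finset.univ (α := Fin m)) fun l _ =>
      Φ.integral_signedSlice_partialDeriv_natAdd hΩ (hmem _) l, add_zero, Finset.mul_sum,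
    ← Finset.sum_neg_distrib]
  refine Finset.sum_congr rfl fun l _ => ?_
  rw [h1, Φ.localDelta_eq _ (Φ.mulCoordDeriv_mem _ _ hf), List.length_cons, pow_succ, List.map_cons,
    smoothFunctions.iteratedPartial_cons]
  ring

/-- The functional `f p^J ↦ ⟨δ_J(P), χ f⟩` on polynomials with smooth coefficients. -/
def symbolFunctional (hΩ : OrientsSurface P Ω) (χ : compactlySupportedIn Φ.toChart.source) :
    MvPolynomial (Fin k) (smoothFunctions (k + m)) →+ ℝ :=
  -- Multiplying by `χ` makes the functional defined for arbitrary smooth coefficients; on functions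
  -- supported where `χ = 1` the cutoff is invisible.
  MvPolynomial.sumMonomials fun d => (Φ.localDeltaHom hΩ (Finsupp.toMultiset d).toList).comp
    (LinearMap.toSpanSingleton (smoothFunctions (k + m)) _ χ).toAddMonoidHom

variable {χ : compactlySupportedIn Φ.toChart.source}

/-- The functions supported in the set where `χ = 1`. -/
def unitIdeal {d : ℕ} (χ : smoothFunctions d) : Ideal (smoothFunctions d) :=
  compactlySupportedIn {x | (χ : _ → ℝ) x = 1}

theorem mul_eq_of_mem_unitIdeal {d : ℕ} {χ g : smoothFunctions d} (hg : g ∈ unitIdeal χ) :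
    g * χ = g := by
  ext x
  change (g : _ → ℝ) x * (χ : _ → ℝ) x = (g : _ → ℝ) x
  by_cases hx : x ∈ tsupport (g : _ → ℝ)
  · rw [show (χ : _ → ℝ) x = 1 from hg.2 hx, mul_one]
  · rw [image_eq_zero_of_notMem_tsupport hx, zero_mul]

theorem mem_source_of_mem_unitIdeal {g : smoothFunctions (k + m)}
    (hg : g ∈ unitIdeal (χ : smoothFunctions (k + m))) :
    g ∈ compactlySupportedIn Φ.toChart.source := by
  rw [← mul_eq_of_mem_unitIdeal hg]
  exact Ideal.mul_mem_left _ _ χ.2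

theorem symbolFunctional_monomial (hΩ : OrientsSurface P Ω) {g : smoothFunctions (k + m)}
    (hg : g ∈ unitIdeal (χ : smoothFunctions (k + m))) {d : Fin k →₀ ℕ} {I : List (Fin k)}
    (hI : (I : Multiset (Fin k)) = Finsupp.toMultiset d) :
    Φ.symbolFunctional hΩ χ (MvPolynomial.monomial d g) = Φ.localDelta Ω I g := by
  rw [symbolFunctional, MvPolynomial.sumMonomials_monomial]
  change Φ.localDelta Ω _ (g * (χ : smoothFunctions (k + m)) : smoothFunctions (k + m)) = _
  rw [mul_eq_of_mem_unitIdeal hg]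
  refine Φ.localDelta_perm ?_ (Φ.mem_source_of_mem_unitIdeal hg)
  rw [← Multiset.coe_eq_coe, Multiset.coe_toList, hI]

theorem symbolFunctional_C_mul_prod (hΩ : OrientsSurface P Ω) {g : smoothFunctions (k + m)}
    (hg : g ∈ unitIdeal (χ : smoothFunctions (k + m))) (I : List (Fin k)) :
    Φ.symbolFunctional hΩ χ (MvPolynomial.C g * (I.map MvPolynomial.X).prod) =
      Φ.localDelta Ω I g := by
  have h : (I.map (MvPolynomial.X (R := smoothFunctions (k + m)))).prod =
      MvPolynomial.monomial (Multiset.toFinsupp (I : Multiset (Fin k))) 1 := by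
    induction I with
    | nil => simp
    | cons i I ih =>
      rw [List.map_cons, List.prod_cons, ih, ← Multiset.cons_coe, ← Multiset.singleton_add, map_add,
        Multiset.toFinsupp_singleton, MvPolynomial.X, MvPolynomial.monomial_mul, mul_one]
  rw [h, MvPolynomial.C_mul_monomial, mul_one]
  exact Φ.symbolFunctional_monomial hΩ hg (by simp)

theorem isDeltaFunctional_symbolFunctional (hΩ : OrientsSurface P Ω)
    {p : Fin k → smoothFunctions (k + m)} (hp : ∀ l, (p l : _ → ℝ) = P l) :
    IsDeltaFunctional smoothFunctions.partialDeriv (unitIdeal (χ : smoothFunctions (k + m))) p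
      (Φ.symbolFunctional hΩ χ) where
  mul_coord b g hg τ := by
    induction τ using MvPolynomial.induction_on' with
    | add τ₁ τ₂ h₁ h₂ => rw [mul_add, mul_add, map_add, map_add, map_add, h₁, h₂, neg_add]
    | monomial d c =>
      have hgc : g * c ∈ unitIdeal (χ : smoothFunctions (k + m)) := Ideal.mul_mem_right _ _ hg
      set I := (Finsupp.toMultiset d).toList with hI
      have hId : (I : Multiset (Fin k)) = Finsupp.toMultiset d := Multiset.coe_toList _
      have hcount : I.count b = d b := by
        rw [← Multiset.coe_count, hId, Finsupp.count_toMultiset]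
      have herase : ((I.erase b : List (Fin k)) : Multiset (Fin k)) =
          Finsupp.toMultiset (d - Finsupp.single b 1) := by
        rw [← Multiset.coe_erase, hId]
        ext i
        rw [Finsupp.count_toMultiset, Finsupp.tsub_apply]
        by_cases hib : i = b
        · subst hib
          rw [Multiset.count_erase_self, Finsupp.count_toMultiset, Finsupp.single_eq_same]
        · rw [Multiset.count_erase_of_ne hib, Finsupp.count_toMultiset,
            Finsupp.single_eq_of_ne hib, tsub_zero]
      rw [MvPolynomial.C_mul_monomial, MvPolynomial.C_mul_monomial, MvPolynomial.pderiv_monomial,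
        Φ.symbolFunctional_monomial hΩ (Ideal.mul_mem_left _ _ hgc) hId,
        Φ.localDelta_mul_coord b I (hp b) (Φ.mem_source_of_mem_unitIdeal hgc), hcount,
        mul_comm (g * c), ← nsmul_eq_mul (d b) (g * c), map_nsmul, map_nsmul,
        Φ.symbolFunctional_monomial hΩ hgc herase, nsmul_eq_mul]
  chain_rule j g hg τ := by
    induction τ using MvPolynomial.induction_on' with
    | add τ₁ τ₂ h₁ h₂ =>
      simp only [mul_add (MvPolynomial.C g), mul_add (MvPolynomial.C _ * MvPolynomial.X _),
        Finset.sum_add_distrib]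
      rw [map_add, map_add, map_add, neg_add, h₁, h₂]
    | monomial d c =>
      have hgc : g * c ∈ unitIdeal (χ : smoothFunctions (k + m)) := Ideal.mul_mem_right _ _ hg
      set I := (Finsupp.toMultiset d).toList with hI
      have hId : (I : Multiset (Fin k)) = Finsupp.toMultiset d := Multiset.coe_toList _
      have h1 : ∀ l, ((l :: I : List (Fin k)) : Multiset (Fin k)) =
          Finsupp.toMultiset (Finsupp.single l 1 + d) := fun l => by
        rw [map_add, ← Multiset.cons_coe, hId, ← Multiset.singleton_add]
        simp
      rw [MvPolynomial.C_mul_monomial, MvPolynomial.mapDerivation_monomial,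
        Φ.symbolFunctional_monomial hΩ (compactlySupportedIn.partialDeriv_mem hgc j) hId,
        ← Φ.localDelta_chain_rule hΩ j I hp (Φ.mem_source_of_mem_unitIdeal hgc), map_sum]
      refine Finset.sum_congr rfl fun l _ => ?_
      rw [mul_assoc, MvPolynomial.X, MvPolynomial.monomial_mul, MvPolynomial.C_mul_monomial, one_mul,
        Φ.symbolFunctional_monomial hΩ (Ideal.mul_mem_left _ _ hgc) (h1 l)]

end AdaptedChart

/-! ### Comparison of charts of the two grids, and the case `s = 0`. -/

section Transition

variable {k m : ℕ} {P Q : Fin k → (Fin (k + m) → ℝ) → ℝ}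
  {α β : (Fin (k + m) → ℝ) → Matrix (Fin k) (Fin k) ℝ}
  {Ω : (Fin (k + m) → ℝ) → (Fin (k + m) → ℝ) [⋀^Fin m]→L[ℝ] ℝ}

theorem zeroSurface_subset_of_combination (hQP : ∀ i x, Q i x = ∑ j, P j x * α x j i) :
    zeroSurface P ⊆ zeroSurface Q := fun x hx i => by
  rw [hQP]
  exact Finset.sum_eq_zero fun j _ => by rw [hx j, zero_mul]

/-- On the surface the terms `P j · dα` drop out, so only `α` itself, not its derivative, relates
the differentials. -/
theorem fderiv_combination (hP : ∀ i, ContDiff ℝ ∞ (P i))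
    (hα : ∀ i j, ContDiff ℝ ∞ fun x => α x i j) (hQP : ∀ i x, Q i x = ∑ j, P j x * α x j i)
    {x : Fin (k + m) → ℝ} (hx : x ∈ zeroSurface P) (i : Fin k) (w : Fin (k + m) → ℝ) :
    fderiv ℝ (Q i) x w = ∑ j, α x j i * fderiv ℝ (P j) x w := by
  have h : HasFDerivAt (Q i) (∑ j, (P j x • fderiv ℝ (fun y => α y j i) x +
      α x j i • fderiv ℝ (P j) x)) x := by
    rw [show Q i = fun y => ∑ j, P j y * α y j i from funext (hQP i)]
    exact HasFDerivAt.fun_sum fun j _ =>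
      ((hP j).differentiable (by simp) x).hasFDerivAt.fun_mul
        ((hα j i).differentiable (by simp) x).hasFDerivAt
  rw [h.fderiv]
  simp only [sum_apply, smul_apply, hx _, zero_smul, zero_add, smul_eq_mul]

theorem OrientsSurface.of_combination (hΩ : OrientsSurface P Ω) (hP : ∀ i, ContDiff ℝ ∞ (P i))
    (hα : ∀ i j, ContDiff ℝ ∞ fun x => α x i j) (hQP : ∀ i x, Q i x = ∑ j, P j x * α x j i)
    (hPQ : ∀ i x, P i x = ∑ j, Q j x * β x j i) : OrientsSurface Q Ω := by
  have hS : zeroSurface Q = zeroSurface P :=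
    (zeroSurface_subset_of_combination hPQ).antisymm (zeroSurface_subset_of_combination hQP)
  refine ⟨hS ▸ hΩ.1, fun x hx => ?_⟩
  obtain ⟨w, hw, hne⟩ := hΩ.2 x (hS ▸ hx)
  refine ⟨w, fun l i => ?_, hne⟩
  rw [fderiv_combination hP hα hQP (hS ▸ hx)]
  exact Finset.sum_eq_zero fun j _ => by rw [hw, mul_zero]

/-- This trades the absolute Jacobian of the substitution formula for a signed one; `a` will be the
Jacobian of the transition map and `c` the orienting form on a frame. -/
theorem Real.sign_mul_mul_self (a c : ℝ) : Real.sign (c * a) * a = |a| * Real.sign c := by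
  rcases lt_trichotomy a 0 with ha | rfl | ha
  · rw [abs_of_neg ha]
    rcases lt_trichotomy c 0 with hc | rfl | hc
    · rw [Real.sign_of_pos (mul_pos_of_neg_of_neg hc ha), Real.sign_of_neg hc]; ring
    · simp
    · rw [Real.sign_of_neg (mul_neg_of_pos_of_neg hc ha), Real.sign_of_pos hc]; ring
  · simp
  · rw [abs_of_pos ha]
    rcases lt_trichotomy c 0 with hc | rfl | hc
    · rw [Real.sign_of_neg (mul_neg_of_neg_of_pos hc ha), Real.sign_of_neg hc]; ring
    · simp
    · rw [Real.sign_of_pos (mul_pos hc ha), Real.sign_of_pos hc]; ring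

namespace AdaptedChart

variable (Φ : AdaptedChart P) (Ψ : AdaptedChart Q)

/-- The parameters of the part of the surface covered by a second chart. -/
def overlap : Set (Fin m → ℝ) :=
  {v | appendZero k m v ∈ Φ.toChart.target ∧
    Φ.toChart.symm (appendZero k m v) ∈ Ψ.toChart.source}

/-- The change of coordinates on the surface between two charts. -/
def transition (v : Fin m → ℝ) : Fin m → ℝ :=
  fun l => Ψ.toChart (Φ.toChart.symm (appendZero k m v)) (Fin.natAdd k l)

theorem isOpen_overlap : IsOpen (Φ.overlap Ψ) :=
  (Φ.toChart.symm.isOpen_inter_preimage Ψ.toChart.open_source).preimage (appendZero k m).continuous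

variable {Φ Ψ}

theorem appendZero_transition (hS : zeroSurface P ⊆ zeroSurface Q) {v : Fin m → ℝ}
    (hv : v ∈ Φ.overlap Ψ) : appendZero k m (Φ.transition Ψ v) =
      Ψ.toChart (Φ.toChart.symm (appendZero k m v)) :=
  (eq_appendZero fun i => by
    rw [Ψ.coord_eq _ hv.2]
    exact hS (Φ.symm_mem_zeroSurface hv.1) i).symm

theorem symm_transition (hS : zeroSurface P ⊆ zeroSurface Q) {v : Fin m → ℝ}
    (hv : v ∈ Φ.overlap Ψ) : Ψ.toChart.symm (appendZero k m (Φ.transition Ψ v)) =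
      Φ.toChart.symm (appendZero k m v) := by
  rw [appendZero_transition hS hv, Ψ.toChart.left_inv hv.2]

theorem transition_mem (hS : zeroSurface P ⊆ zeroSurface Q) {v : Fin m → ℝ}
    (hv : v ∈ Φ.overlap Ψ) : Φ.transition Ψ v ∈ Ψ.overlap Φ := by
  refine ⟨?_, ?_⟩
  · rw [appendZero_transition hS hv]
    exact Ψ.toChart.map_source hv.2
  · rw [symm_transition hS hv]
    exact Φ.toChart.map_target hv.1

theorem transition_transition (hS : zeroSurface P ⊆ zeroSurface Q) {v : Fin m → ℝ}
    (hv : v ∈ Φ.overlap Ψ) : Ψ.transition Φ (Φ.transition Ψ v) = v := by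
  ext l
  rw [transition, symm_transition hS hv, Φ.toChart.right_inv hv.1, appendZero_natAdd]

theorem injOn_transition (hS : zeroSurface P ⊆ zeroSurface Q) :
    Set.InjOn (Φ.transition Ψ) (Φ.overlap Ψ) := fun v hv w hw h => by
  rw [← transition_transition hS hv, h, transition_transition hS hw]

theorem image_transition (hS : zeroSurface P = zeroSurface Q) :
    Φ.transition Ψ '' Φ.overlap Ψ = Ψ.overlap Φ := by
  refine Set.Subset.antisymm ?_ fun v hv => ?_
  · rintro _ ⟨v, hv, rfl⟩
    exact transition_mem hS.subset hv
  · exact ⟨_, transition_mem hS.superset hv, transition_transition hS.superset hv⟩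

theorem hasFDerivAt_chart_comp {v : Fin m → ℝ} (hv : v ∈ Φ.overlap Ψ) :
    HasFDerivAt (fun v => Ψ.toChart (Φ.toChart.symm (appendZero k m v)))
      (((fderiv ℝ Ψ.toChart (Φ.toChart.symm (appendZero k m v))).comp
        (fderiv ℝ Φ.toChart.symm (appendZero k m v))).comp (appendZero k m)) v :=
  ((Ψ.hasFDerivAt hv.2).comp _ (Φ.hasFDerivAt_symm hv.1)).comp v (appendZero k m).hasFDerivAt

theorem hasFDerivAt_transition {v : Fin m → ℝ} (hv : v ∈ Φ.overlap Ψ) :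
    HasFDerivAt (Φ.transition Ψ) (fderiv ℝ (Φ.transition Ψ) v) v :=
  DifferentiableAt.hasFDerivAt (differentiableAt_pi.2 fun l =>
    (hasFDerivAt_pi'.1 (hasFDerivAt_chart_comp hv) (Fin.natAdd k l)).differentiableAt)

theorem appendZero_fderiv_transition (hS : zeroSurface P ⊆ zeroSurface Q) {v : Fin m → ℝ}
    (hv : v ∈ Φ.overlap Ψ) (w : Fin m → ℝ) :
    appendZero k m (fderiv ℝ (Φ.transition Ψ) v w) =
      fderiv ℝ Ψ.toChart (Φ.toChart.symm (appendZero k m v))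
        (fderiv ℝ Φ.toChart.symm (appendZero k m v) (appendZero k m w)) := by
  have h1 := (appendZero k m).hasFDerivAt.comp v (hasFDerivAt_transition hv)
  have h2 := h1.unique ((hasFDerivAt_chart_comp hv).congr_of_eventuallyEq (by
    filter_upwards [(Φ.isOpen_overlap Ψ).mem_nhds hv] with v' hv'
    exact appendZero_transition hS hv'))
  exact congrArg (· w) h2

theorem det_transition_eq (v : Fin m → ℝ) :
    (Matrix.of fun l => fderiv ℝ (Φ.transition Ψ) v (Pi.single l 1)).det =
      (fderiv ℝ (Φ.transition Ψ) v).det := by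
  rw [← Matrix.det_transpose, ContinuousLinearMap.det, ← LinearMap.det_toMatrix']
  congr 1

/-- The frames of two charts differ by the derivative of the transition map. -/
theorem orientation_frame_transition (hS : zeroSurface P ⊆ zeroSurface Q) {v : Fin m → ℝ}
    (hv : v ∈ Φ.overlap Ψ) :
    Ω (Φ.toChart.symm (appendZero k m v)) (fun l : Fin m =>
      fderiv ℝ Φ.toChart.symm (appendZero k m v) (Pi.single (Fin.natAdd k l) 1)) =
    Ω (Φ.toChart.symm (appendZero k m v)) (fun l : Fin m =>
      fderiv ℝ Ψ.toChart.symm (appendZero k m (Φ.transition Ψ v))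
        (Pi.single (Fin.natAdd k l) 1)) * (fderiv ℝ (Φ.transition Ψ) v).det := by
  have h : ∀ l : Fin m, fderiv ℝ Φ.toChart.symm (appendZero k m v)
      (Pi.single (Fin.natAdd k l) 1) =
      ((fderiv ℝ Ψ.toChart.symm (appendZero k m (Φ.transition Ψ v))).comp (appendZero k m))
        (fderiv ℝ (Φ.transition Ψ) v (Pi.single l 1)) := fun l => by
    rw [ContinuousLinearMap.comp_apply, appendZero_fderiv_transition hS hv,
      appendZero_transition hS hv, Ψ.fderiv_symm_comp_fderiv hv.2, appendZero_single]
  rw [funext h, ContinuousAlternatingMap.comp_apply_eq_mul_det, det_transition_eq]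
  simp only [ContinuousLinearMap.comp_apply, appendZero_single]

/-- The Jacobians of two charts along the surface. -/
theorem det_jacobian_transition (hP : ∀ i, ContDiff ℝ ∞ (P i))
    (hα : ∀ i j, ContDiff ℝ ∞ fun x => α x i j) (hQP : ∀ i x, Q i x = ∑ j, P j x * α x j i)
    {v : Fin m → ℝ} (hv : v ∈ Φ.overlap Ψ) :
    (Φ.jacobian (appendZero k m v)).det =
      (Ψ.jacobian (appendZero k m (Φ.transition Ψ v))).det *
        ((α (Φ.toChart.symm (appendZero k m v))).det * (fderiv ℝ (Φ.transition Ψ) v).det) := by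
  have hS := zeroSurface_subset_of_combination hQP
  set x := Φ.toChart.symm (appendZero k m v) with hx
  have hΨx : appendZero k m (Φ.transition Ψ v) = Ψ.toChart x := appendZero_transition hS hv
  set M := (fderiv ℝ Ψ.toChart x).comp (fderiv ℝ Φ.toChart.symm (appendZero k m v)) with hM
  have h1 : fderiv ℝ Φ.toChart.symm (appendZero k m v) =
      (fderiv ℝ Ψ.toChart.symm (appendZero k m (Φ.transition Ψ v))).comp M := by
    ext1 w
    rw [ContinuousLinearMap.comp_apply, hM, ContinuousLinearMap.comp_apply, hΨx,
      Ψ.fderiv_symm_comp_fderiv hv.2]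
  have h2 : M.det = (α x).det * (fderiv ℝ (Φ.transition Ψ) v).det := by
    -- Along the surface `dQ` involves only `dP`, through `α`, so the `v`-derivatives of the
    -- `Q`-coordinates vanish; the lower right block is the derivative of the transition map.
    have hblock : (LinearMap.toMatrix' (M : (Fin (k + m) → ℝ) →ₗ[ℝ] _)).submatrix finSumFinEquiv
        finSumFinEquiv = Matrix.fromBlocks (α x).transpose 0
          (Matrix.of fun l j => M (Pi.single (Fin.castAdd m j) 1) (Fin.natAdd k l))
          (Matrix.of fun l => fderiv ℝ (Φ.transition Ψ) v (Pi.single l 1)).transpose := by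
      have hdP : ∀ (j : Fin k) (w : Fin (k + m) → ℝ), fderiv ℝ (P j) x
          (fderiv ℝ Φ.toChart.symm (appendZero k m v) w) = w (Fin.castAdd m j) := fun j w => by
        rw [← Φ.fderiv_castAdd (Φ.toChart.map_target hv.1)]
        exact congrFun (congrArg (· w) (Φ.fderiv_comp_fderiv_symm hv.1)) _
      have hMQ : ∀ i w, M w (Fin.castAdd m i) = ∑ j, α x j i * w (Fin.castAdd m j) := fun i w => by
        rw [hM, ContinuousLinearMap.comp_apply, Ψ.fderiv_castAdd hv.2,
          fderiv_combination hP hα hQP (Φ.symm_mem_zeroSurface hv.1)]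
        exact Finset.sum_congr rfl fun j _ => congrArg (α x j i * ·) (hdP j w)
      ext (i | i) (j | j)
      · simp only [Matrix.submatrix_apply, finSumFinEquiv_apply_left, LinearMap.toMatrix'_apply,
          Matrix.fromBlocks_apply₁₁, Matrix.transpose_apply]
        refine (hMQ _ _).trans ?_
        rw [Finset.sum_eq_single j]
        · rw [Pi.single_eq_same, mul_one]
        · intro l _ hl
          rw [Pi.single_eq_of_ne fun h => hl (Fin.castAdd_injective _ _ h), mul_zero]
        · exact fun h => absurd (Finset.mem_univ j) h
      · simp only [Matrix.submatrix_apply, finSumFinEquiv_apply_left, finSumFinEquiv_apply_right,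
          LinearMap.toMatrix'_apply, Matrix.fromBlocks_apply₁₂, Matrix.zero_apply]
        refine (hMQ _ _).trans (Finset.sum_eq_zero fun l _ => ?_)
        rw [← appendZero_single, appendZero_castAdd, mul_zero]
      · simp only [Matrix.submatrix_apply, finSumFinEquiv_apply_left, finSumFinEquiv_apply_right,
          LinearMap.toMatrix'_apply, Matrix.fromBlocks_apply₂₁, Matrix.of_apply]
        rfl
      · simp only [Matrix.submatrix_apply, finSumFinEquiv_apply_right,
          LinearMap.toMatrix'_apply, Matrix.fromBlocks_apply₂₂, Matrix.transpose_apply,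
          Matrix.of_apply]
        rw [← appendZero_natAdd (k := k) (fderiv ℝ (Φ.transition Ψ) v (Pi.single j 1)) i,
          appendZero_fderiv_transition hS hv, appendZero_single]
        rfl
    rw [ContinuousLinearMap.det, ← LinearMap.det_toMatrix', ← Matrix.det_submatrix_equiv_self
      finSumFinEquiv, hblock, Matrix.det_fromBlocks_zero₁₂, Matrix.det_transpose,
      Matrix.det_transpose, det_transition_eq]
  rw [det_jacobian, det_jacobian, ← h2, h1]
  exact LinearMap.det_comp _ _

theorem frameSign_mul_density_eq_zero {f : (Fin (k + m) → ℝ) → ℝ}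
    (hf : Function.support f ⊆ Ψ.toChart.source) {v : Fin m → ℝ} (hv : v ∉ Φ.overlap Ψ) :
    Φ.frameSign Ω (appendZero k m v) * Φ.density f (appendZero k m v) = 0 := by
  by_cases ht : appendZero k m v ∈ Φ.toChart.target
  · have : f (Φ.toChart.symm (appendZero k m v)) = 0 := by
      by_contra h
      exact hv ⟨ht, hf h⟩
    rw [Φ.density_of_mem f ht, this, zero_mul, mul_zero]
  · rw [Φ.density_of_notMem f ht, mul_zero]

/-- The form `ω` with `dP₁ ∧ ⋯ ∧ dP_k ∧ ω = dx₁ ∧ ⋯ ∧ dx_n` is multiplied by `det β` when `P`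
is replaced by `Q`. -/
theorem localDelta_nil_transform (hP : ∀ i, ContDiff ℝ ∞ (P i))
    (hα : ∀ i j, ContDiff ℝ ∞ fun x => α x i j) (hQP : ∀ i x, Q i x = ∑ j, P j x * α x j i)
    (hPQ : ∀ i x, P i x = ∑ j, Q j x * β x j i) (hβα : ∀ x, β x * α x = 1)
    {f : (Fin (k + m) → ℝ) → ℝ} (hfP : Function.support f ⊆ Φ.toChart.source)
    (hfQ : Function.support f ⊆ Ψ.toChart.source) :
    Ψ.localDelta Ω [] f = Φ.localDelta Ω [] fun x => (β x).det * f x := by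
  have hS : zeroSurface P = zeroSurface Q :=
    (zeroSurface_subset_of_combination hQP).antisymm (zeroSurface_subset_of_combination hPQ)
  set G : (Fin m → ℝ) → ℝ := fun v =>
    Ψ.frameSign Ω (appendZero k m v) * Ψ.density f (appendZero k m v) with hG
  set F : (Fin m → ℝ) → ℝ := fun v => Φ.frameSign Ω (appendZero k m v) *
    Φ.density (fun x => (β x).det * f x) (appendZero k m v) with hF
  have hL : Ψ.localDelta Ω [] f = ∫ v, G v := by
    rw [localDelta, List.length_nil, pow_zero, one_mul]; rfl
  have hR : (Φ.localDelta Ω [] fun x => (β x).det * f x) = ∫ v, F v := by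
    rw [localDelta, List.length_nil, pow_zero, one_mul]; rfl
  have hG0 : ∫ v, G v = ∫ v in Ψ.overlap Φ, G v :=
    (MeasureTheory.setIntegral_eq_integral_of_forall_compl_eq_zero fun v hv =>
      frameSign_mul_density_eq_zero hfP hv).symm
  have hF0 : ∫ v, F v = ∫ v in Φ.overlap Ψ, F v := by
    refine (MeasureTheory.setIntegral_eq_integral_of_forall_compl_eq_zero fun v hv =>
      frameSign_mul_density_eq_zero ?_ hv).symm
    exact (Function.support_mul_subset_right _ _).trans hfQ
  have hmeas : MeasurableSet (Φ.overlap Ψ) := (Φ.isOpen_overlap Ψ).measurableSet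
  -- Both integrands vanish off the overlaps, which the transition map carries bijectively onto each
  -- other.
  rw [hL, hR, hG0, hF0, ← image_transition hS,
    MeasureTheory.integral_image_eq_integral_abs_det_fderiv_smul _ hmeas
      (fun v hv => (hasFDerivAt_transition hv).hasFDerivWithinAt) (injOn_transition hS.subset)]
  refine MeasureTheory.setIntegral_congr_fun hmeas fun v hv => ?_
  have hsign := orientation_frame_transition (Ω := Ω) hS.subset hv
  have hdet := det_jacobian_transition hP hα hQP hv
  have hβα' : (β (Φ.toChart.symm (appendZero k m v))).det *
      (α (Φ.toChart.symm (appendZero k m v))).det = 1 := by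
    rw [← Matrix.det_mul, hβα, Matrix.det_one]
  simp only [hG, hF, smul_eq_mul]
  rw [Φ.density_of_mem _ hv.1, Ψ.density_of_mem _ (transition_mem hS.subset hv).1, frameSign,
    frameSign, symm_transition hS.subset hv, hsign, hdet]
  set x := Φ.toChart.symm (appendZero k m v)
  set c := Ω x fun l : Fin m => fderiv ℝ Ψ.toChart.symm (appendZero k m (Φ.transition Ψ v))
    (Pi.single (Fin.natAdd k l) 1)
  set a := (fderiv ℝ (Φ.transition Ψ) v).det
  set J := (Ψ.jacobian (appendZero k m (Φ.transition Ψ v))).det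
  -- Here `c * a` is the orienting form on the frame of `Φ`, and the factor inserted is `det β · det
  -- α = 1`.
  calc |a| * (Real.sign c * (f x * J)) = (|a| * Real.sign c) * (f x * J) := by ring
    _ = Real.sign (c * a) * a * (f x * J) * ((β x).det * (α x).det) := by
      rw [hβα', Real.sign_mul_mul_self, mul_one]
    _ = _ := by ring

end AdaptedChart

end Transition

/-! ### Matrices over the ring of smooth functions. -/

namespace smoothFunctions

variable {d : ℕ}

/-- Evaluation at a point. -/
def evalHom (x : Fin d → ℝ) : smoothFunctions d →+* ℝ where
  toFun f := (f : (Fin d → ℝ) → ℝ) x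
  map_one' := rfl
  map_mul' _ _ := rfl
  map_zero' := rfl
  map_add' _ _ := rfl

theorem evalHom_apply (x : Fin d → ℝ) (f : smoothFunctions d) :
    evalHom x f = (f : (Fin d → ℝ) → ℝ) x := rfl

theorem ext_evalHom {f g : smoothFunctions d} (h : ∀ x, evalHom x f = evalHom x g) : f = g :=
  Subtype.ext (funext h)

/-- A matrix of smooth functions, as a matrix over the ring of smooth functions. -/
def ofMatrix {κ : Type*} {M : (Fin d → ℝ) → Matrix κ κ ℝ}
    (hM : ∀ i j, ContDiff ℝ ∞ fun x => M x i j) : Matrix κ κ (smoothFunctions d) :=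
  Matrix.of fun i j => ⟨fun x => M x i j, mem_iff.2 (hM i j)⟩

theorem evalHom_ofMatrix {κ : Type*} {M : (Fin d → ℝ) → Matrix κ κ ℝ}
    (hM : ∀ i j, ContDiff ℝ ∞ fun x => M x i j) (x : Fin d → ℝ) (i j : κ) :
    evalHom x (ofMatrix hM i j) = M x i j := rfl

section Matrix

variable {κ : Type*} [Fintype κ] [DecidableEq κ] {M N : (Fin d → ℝ) → Matrix κ κ ℝ}
  (hM : ∀ i j, ContDiff ℝ ∞ fun x => M x i j) (hN : ∀ i j, ContDiff ℝ ∞ fun x => N x i j)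

theorem evalHom_det (x : Fin d → ℝ) : evalHom x (ofMatrix hM).det = (M x).det := by
  rw [RingHom.map_det]
  rfl

theorem ofMatrix_mul_eq_one (h : ∀ x, M x * N x = 1) : ofMatrix hM * ofMatrix hN = 1 := by
  ext1 i j
  refine ext_evalHom fun x => ?_
  rw [Matrix.mul_apply, map_sum]
  simp only [map_mul, evalHom_ofMatrix]
  rw [← Matrix.mul_apply, h, Matrix.one_apply, Matrix.one_apply]
  split_ifs <;> simp

/-- Jacobi's formula for the derivative of a determinant. -/
theorem partialDeriv_det (h : ∀ x, M x * N x = 1) (j : Fin d) :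
    partialDeriv j (ofMatrix hM).det = (ofMatrix hM).det *
      ∑ a, ∑ b, ofMatrix hN b a * partialDeriv j (ofMatrix hM a b) := by
  refine ext_evalHom fun x => ?_
  have hadj : (M x).adjugate = (M x).det • N x := by
    have := congrArg (· * N x) (Matrix.adjugate_mul (M x))
    simpa [mul_assoc, h] using this
  have hdet := HasFDerivAt.matrix_det (M := M) (x := x)
    fun a b => ((hM a b).differentiable (by simp) x).hasFDerivAt
  rw [evalHom_apply, partialDeriv_apply,
    show (((ofMatrix hM).det : smoothFunctions d) : (Fin d → ℝ) → ℝ) = fun y => (M y).det from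
      funext fun y => evalHom_det hM y, hdet.fderiv, map_mul, evalHom_det]
  simp only [sum_apply, smul_apply, smul_eq_mul, hadj, Matrix.smul_apply, map_sum, map_mul,
    Finset.mul_sum, mul_assoc]
  rfl

end Matrix

end smoothFunctions

/-- Smooth cutoff functions. -/
theorem exists_compactlySupportedIn_eq_one {d : ℕ} {K U : Set (Fin d → ℝ)} (hK : IsCompact K)
    (hU : IsOpen U) (hKU : K ⊆ U) :
    ∃ χ ∈ compactlySupportedIn U, ∀ x ∈ K, (χ : (Fin d → ℝ) → ℝ) x = 1 := by
  obtain ⟨L, hL, hKL, hLU⟩ := exists_compact_between hK hU hKU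
  obtain ⟨χ, h0, h1, -⟩ := exists_contMDiffMap_zero_one_of_isClosed
    (n := ⊤) 𝓘(ℝ, Fin d → ℝ) (s := (interior L)ᶜ) (t := K)
    isOpen_interior.isClosed_compl hK.isClosed (Set.disjoint_compl_left_iff_subset.2 hKL)
  have hsupp : tsupport χ ⊆ L := by
    refine closure_minimal (fun x hx => ?_) hL.isClosed
    by_contra hxL
    exact hx (h0 fun h => hxL (interior_subset h))
  exact ⟨⟨χ, smoothFunctions.mem_iff.2 χ.contMDiff.contDiff⟩,
    ⟨hL.of_isClosed_subset (isClosed_tsupport _) hsupp, hsupp.trans hLU⟩, h1⟩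

/-! ### The transformation law for functions supported in a chart of each grid. -/

namespace AdaptedChart

variable {k m : ℕ} {P Q : Fin k → (Fin (k + m) → ℝ) → ℝ}
  {α β : (Fin (k + m) → ℝ) → Matrix (Fin k) (Fin k) ℝ}
  {Ω : (Fin (k + m) → ℝ) → (Fin (k + m) → ℝ) [⋀^Fin m]→L[ℝ] ℝ}
  {Φ : AdaptedChart P} {Ψ : AdaptedChart Q}

/-- A component of the coordinate vector field `∂/∂uᵢ`, cut off outside the chart. -/
def coordField (Φ : AdaptedChart P) (χ : smoothFunctions (k + m))
    (hχ : χ ∈ compactlySupportedIn Φ.toChart.source) (i : Fin k) (j : Fin (k + m)) :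
    smoothFunctions (k + m) :=
  ⟨fun x => (χ : _ → ℝ) x *
    fderiv ℝ Φ.toChart.symm (Φ.toChart x) (Pi.single (Fin.castAdd m i) 1) j, by
    refine smoothFunctions.mem_iff.2 (contDiff_of_contDiffAt_tsupport fun x hx => ?_)
    have hxs := hχ.2 (tsupport_mul_subset_left hx)
    refine (smoothFunctions.contDiff χ).contDiffAt.mul (contDiffAt_pi.1 ?_ j)
    exact (((Φ.contDiffAt_symm (Φ.toChart.map_source hxs)).fderiv_right (m := ∞) (by simp)).comp x
      (Φ.contDiffAt hxs)).clm_apply contDiffAt_const⟩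

/-- The field `∂/∂uᵢ` is dual to the differentials of the `P l` where `χ = 1`, and `g` vanishes
elsewhere. It serves as the field `Y` of `IsDeltaFunctional.transform`. -/
theorem sum_coordField_mul_partialDeriv {χ : smoothFunctions (k + m)}
    (hχ : χ ∈ compactlySupportedIn Φ.toChart.source) {p : Fin k → smoothFunctions (k + m)}
    (hp : ∀ l, (p l : _ → ℝ) = P l) (i l : Fin k) {g : smoothFunctions (k + m)}
    (hg : g ∈ unitIdeal χ) :
    ∑ j, g * Φ.coordField χ hχ i j * smoothFunctions.partialDeriv j (p l) =
      g * (1 : Matrix (Fin k) (Fin k) (smoothFunctions (k + m))) i l := by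
  refine smoothFunctions.ext_evalHom fun x => ?_
  simp only [map_sum, map_mul, mul_assoc, ← Finset.mul_sum]
  by_cases hx : x ∈ tsupport (g : _ → ℝ)
  · have hχx : (χ : _ → ℝ) x = 1 := hg.2 hx
    have hxs : x ∈ Φ.toChart.source := hχ.2 (subset_tsupport _ (by
      rw [Function.mem_support, hχx]; exact one_ne_zero))
    congr 1
    set w := fderiv ℝ Φ.toChart.symm (Φ.toChart x) (Pi.single (Fin.castAdd m i) 1) with hw
    have h1 : ∀ j, smoothFunctions.evalHom x (Φ.coordField χ hχ i j) = w j := fun j => by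
      change (χ : _ → ℝ) x * w j = w j
      rw [hχx, one_mul]
    have h2 : ∀ j, smoothFunctions.evalHom x (smoothFunctions.partialDeriv j (p l)) =
        fderiv ℝ (P l) x (Pi.single j 1) := fun j => by
      rw [smoothFunctions.evalHom_apply, smoothFunctions.partialDeriv_apply, hp]
    have h3 : fderiv ℝ (P l) x w = ∑ j, w j * fderiv ℝ (P l) x (Pi.single j 1) := by
      conv_lhs => rw [pi_eq_sum_univ' w]
      simp
    have h4 : fderiv ℝ Φ.toChart x w = Pi.single (Fin.castAdd m i) 1 := by
      have h := Φ.fderiv_comp_fderiv_symm (Φ.toChart.map_source hxs)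
      rw [Φ.toChart.left_inv hxs] at h
      exact congrArg (· (Pi.single (Fin.castAdd m i) 1)) h
    simp only [h1, h2]
    rw [← h3, ← Φ.fderiv_castAdd hxs, h4, Matrix.one_apply]
    split_ifs with hil
    · subst hil; simp
    · rw [map_zero, Pi.single_eq_of_ne]
      exact fun h => hil (Fin.castAdd_injective _ _ h).symm
  · have : (g : (Fin (k + m) → ℝ) → ℝ) x = 0 := image_eq_zero_of_notMem_tsupport hx
    rw [smoothFunctions.evalHom_apply, this, zero_mul, zero_mul]

/-- The transformation law on functions supported in a chart of each of the two grids. -/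
theorem localDelta_transform (hΩ : OrientsSurface P Ω)
    (hP : ∀ i, ContDiff ℝ ∞ (P i)) (hQ : ∀ i, ContDiff ℝ ∞ (Q i))
    (hα : ∀ i j, ContDiff ℝ ∞ fun x => α x i j) (hβ : ∀ i j, ContDiff ℝ ∞ fun x => β x i j)
    (hQP : ∀ i x, Q i x = ∑ j, P j x * α x j i) (hPQ : ∀ i x, P i x = ∑ j, Q j x * β x j i)
    (hβα : ∀ x, β x * α x = 1)
    {τ : Type*} {I : List (Fin k)} {s : Finset τ} {J : τ → List (Fin k)}
    {c : τ → smoothFunctions (k + m)}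
    (hexp : (I.map (symbolForm (smoothFunctions.ofMatrix hβ))).prod =
      ∑ t ∈ s, MvPolynomial.C (c t) * ((J t).map MvPolynomial.X).prod)
    {f : smoothFunctions (k + m)} (hfP : f ∈ compactlySupportedIn Φ.toChart.source)
    (hfQ : f ∈ compactlySupportedIn Ψ.toChart.source) :
    Ψ.localDelta Ω I f = ∑ t ∈ s, Φ.localDelta Ω (J t)
      ((smoothFunctions.ofMatrix hβ).det * c t * f : smoothFunctions (k + m)) := by
  -- One cutoff supported in both charts serves both functionals, so they share the ideal on which
  -- the symbolic rules hold.
  obtain ⟨χ, hχ, hχ1⟩ := exists_compactlySupportedIn_eq_one hfP.1.isCompact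
    (Φ.toChart.open_source.inter Ψ.toChart.open_source) (Set.subset_inter hfP.2 hfQ.2)
  have hχP := compactlySupportedIn.mono Set.inter_subset_left hχ
  have hχQ := compactlySupportedIn.mono Set.inter_subset_right hχ
  have hf : f ∈ unitIdeal χ := ⟨hfP.1, hχ1⟩
  have hΩQ : OrientsSurface Q Ω := hΩ.of_combination hP hα hQP hPQ
  set p : Fin k → smoothFunctions (k + m) := fun l => ⟨P l, smoothFunctions.mem_iff.2 (hP l)⟩
  set q : Fin k → smoothFunctions (k + m) := fun l => ⟨Q l, smoothFunctions.mem_iff.2 (hQ l)⟩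
  set T := Φ.symbolFunctional hΩ ⟨χ, hχP⟩ with hT
  set U := Ψ.symbolFunctional hΩQ ⟨χ, hχQ⟩ with hU
  have hTd : IsDeltaFunctional smoothFunctions.partialDeriv (unitIdeal χ) p T :=
    Φ.isDeltaFunctional_symbolFunctional (χ := ⟨χ, hχP⟩) hΩ fun _ => rfl
  have hUd : IsDeltaFunctional smoothFunctions.partialDeriv (unitIdeal χ) q U :=
    Ψ.isDeltaFunctional_symbolFunctional (χ := ⟨χ, hχQ⟩) hΩQ fun _ => rfl
  have hTC : ∀ g ∈ unitIdeal χ, ∀ I : List (Fin k),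
      T (MvPolynomial.C g * (I.map MvPolynomial.X).prod) = Φ.localDelta Ω I g := fun g hg I =>
    Φ.symbolFunctional_C_mul_prod (χ := ⟨χ, hχP⟩) hΩ hg I
  have hUC : ∀ g ∈ unitIdeal χ, ∀ I : List (Fin k),
      U (MvPolynomial.C g * (I.map MvPolynomial.X).prod) = Ψ.localDelta Ω I g := fun g hg I =>
    Ψ.symbolFunctional_C_mul_prod (χ := ⟨χ, hχQ⟩) hΩQ hg I
  have hbase : ∀ g ∈ unitIdeal χ, U (MvPolynomial.C g) =
      T (MvPolynomial.C ((smoothFunctions.ofMatrix hβ).det * g)) := fun g hg => by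
    have h1 := hUC g hg []
    have h2 := hTC _ (Ideal.mul_mem_left _ (smoothFunctions.ofMatrix hβ).det hg) []
    rw [List.map_nil, List.prod_nil, mul_one] at h1 h2
    rw [h1, h2]
    have hsub : ∀ {V : Set (Fin (k + m) → ℝ)}, χ ∈ compactlySupportedIn V →
        Function.support (g : _ → ℝ) ⊆ V := fun hV x hx => hV.2 (subset_tsupport _ (by
      rw [Function.mem_support, show (χ : _ → ℝ) x = 1 from hg.2 (subset_tsupport _ hx)]
      exact one_ne_zero))
    rw [localDelta_nil_transform hP hα hQP hPQ hβα (hsub hχP) (hsub hχQ)]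
    congr 1
    ext x
    rw [← smoothFunctions.evalHom_det hβ]
    rfl
  have hcomb : ∀ {R S : Fin k → (Fin (k + m) → ℝ) → ℝ}
      {γ : (Fin (k + m) → ℝ) → Matrix (Fin k) (Fin k) ℝ} (hR : ∀ i, ContDiff ℝ ∞ (R i))
      (hS : ∀ i, ContDiff ℝ ∞ (S i)) (hγ : ∀ i j, ContDiff ℝ ∞ fun x => γ x i j),
      (∀ i x, S i x = ∑ j, R j x * γ x j i) → ∀ a,
      (⟨S a, smoothFunctions.mem_iff.2 (hS a)⟩ : smoothFunctions (k + m)) =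
        ∑ b, (⟨R b, smoothFunctions.mem_iff.2 (hR b)⟩ : smoothFunctions (k + m)) *
          smoothFunctions.ofMatrix hγ b a := fun hR hS hγ h a => by
    refine smoothFunctions.ext_evalHom fun x => ?_
    rw [map_sum]
    simp only [map_mul]
    exact h a x
  have key := hTd.transform hUd (fun j g hg => compactlySupportedIn.partialDeriv_mem hg j)
    (hcomb hP hQ hα hQP) (hcomb hQ hP hβ hPQ) (smoothFunctions.ofMatrix_mul_eq_one hβ hα hβα)
    (smoothFunctions.partialDeriv_det hβ hα hβα) (Ψ.coordField χ hχQ)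
    (fun i l g hg => Ψ.sum_coordField_mul_partialDeriv hχQ (fun _ => rfl) i l hg)
    hbase I f hf
  -- Only here is the product of linear forms expanded; since `hexp` is arbitrary, one argument
  -- yields both formulas of the theorem.
  rw [hUC f hf, hexp, Finset.mul_sum, map_sum] at key
  rw [key]
  refine Finset.sum_congr rfl fun t _ => ?_
  rw [← mul_assoc, ← MvPolynomial.C_mul, hTC _ (Ideal.mul_mem_right _ _
    (Ideal.mul_mem_left _ _ hf)), mul_right_comm]

end AdaptedChart

/-! ### Gluing by partitions of unity. -/

section Global

variable {k m : ℕ} {P Q : Fin k → (Fin (k + m) → ℝ) → ℝ}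
  {α β : (Fin (k + m) → ℝ) → Matrix (Fin k) (Fin k) ℝ}
  {Ω : (Fin (k + m) → ℝ) → (Fin (k + m) → ℝ) [⋀^Fin m]→L[ℝ] ℝ}

namespace AdaptedChart

variable (Φ : AdaptedChart P)

theorem localDelta_sum (hΩ : OrientsSurface P Ω) (I : List (Fin k)) {τ : Type*} (s : Finset τ)
    {f : τ → smoothFunctions (k + m)} (hf : ∀ t, f t ∈ compactlySupportedIn Φ.toChart.source) :
    Φ.localDelta Ω I (∑ t ∈ s, f t : smoothFunctions (k + m)) =
      ∑ t ∈ s, Φ.localDelta Ω I (f t) := by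
  have hc : ((∑ t ∈ s, ⟨f t, hf t⟩ : compactlySupportedIn Φ.toChart.source) :
      smoothFunctions (k + m)) = ∑ t ∈ s, f t := by
    rw [AddSubmonoidClass.coe_finsetSum]
  rw [← hc]
  exact map_sum (Φ.localDeltaHom hΩ I) _ s

/-- Transversal derivatives at a point of the surface depend only on the germ there. Agreement near
the surface is thus enough, and the weights sum to `1` only there. -/
theorem localDelta_congr_nhdsSet (I : List (Fin k)) {f g : smoothFunctions (k + m)}
    (hf : f ∈ compactlySupportedIn Φ.toChart.source)
    (hg : g ∈ compactlySupportedIn Φ.toChart.source)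
    (hfg : (f : (Fin (k + m) → ℝ) → ℝ) =ᶠ[𝓝ˢ (zeroSurface P)] g) :
    Φ.localDelta Ω I f = Φ.localDelta Ω I g := by
  have h : ∀ v : Fin m → ℝ, iterPartial (I.map (Fin.castAdd m)) (Φ.density f) (appendZero k m v) =
      iterPartial (I.map (Fin.castAdd m)) (Φ.density g) (appendZero k m v) := fun v => by
    refine (iterPartial_congr ?_ _).eq_of_nhds
    by_cases hv : appendZero k m v ∈ Φ.toChart.target
    · have h1 : (f : _ → ℝ) =ᶠ[𝓝 (Φ.toChart.symm (appendZero k m v))] g :=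
        hfg.filter_mono (nhds_le_nhdsSet (Φ.symm_mem_zeroSurface hv))
      filter_upwards [Φ.density_eventuallyEq f hv, Φ.density_eventuallyEq g hv,
        (Φ.contDiffAt_symm hv).continuousAt.eventually h1] with z hz1 hz2 hz3
      rw [hz1, hz2, hz3]
    · have h0 : ∀ {e : smoothFunctions (k + m)}, e ∈ compactlySupportedIn Φ.toChart.source →
          Φ.density e =ᶠ[𝓝 (appendZero k m v)] 0 := fun he =>
        notMem_tsupport_iff_eventuallyEq.1 fun h => hv (Φ.tsupport_density_subset_target he.1 he.2 h)
      exact (h0 hf).trans (h0 hg).symm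
  rw [localDelta, localDelta]
  simp only [← appendZero_apply, h]

end AdaptedChart

namespace GridAtlas

variable (A : GridAtlas P)

/-- The functions of the partition of unity. -/
def smoothWeight (a : A.ι) : smoothFunctions (k + m) :=
  ⟨A.weight a, smoothFunctions.mem_iff.2 (A.weight_smooth a)⟩

theorem smoothWeight_mul_mem (a : A.ι) {f : smoothFunctions (k + m)}
    (hf : HasCompactSupport (f : (Fin (k + m) → ℝ) → ℝ)) :
    A.smoothWeight a * f ∈ compactlySupportedIn (A.chart a).toChart.source :=
  ⟨HasCompactSupport.mul_left hf,
    (tsupport_mul_subset_left (f := A.weight a)).trans (A.subordinate a)⟩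

/-- Only finitely many functions of the partition of unity are needed on a compact set. -/
theorem exists_finset {f : smoothFunctions (k + m)}
    (hf : HasCompactSupport (f : (Fin (k + m) → ℝ) → ℝ)) :
    ∃ s : Finset A.ι, ∀ a ∉ s, A.smoothWeight a * f = 0 := by
  have hfin := A.locallyFinite.finite_nonempty_inter_compact hf.isCompact
  refine ⟨hfin.toFinset, fun a ha => smoothFunctions.ext_evalHom fun x => ?_⟩
  rw [Set.Finite.mem_toFinset, Set.mem_ofPred_eq, Set.not_nonempty_iff_eq_empty] at ha
  rw [map_mul, map_zero, smoothFunctions.evalHom_apply, smoothFunctions.evalHom_apply]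
  by_contra h
  have : x ∈ Function.support (A.weight a) ∩ tsupport (f : _ → ℝ) :=
    ⟨left_ne_zero_of_mul h, subset_tsupport _ (right_ne_zero_of_mul h)⟩
  rw [ha] at this
  exact this

theorem sum_smoothWeight_mul_eventuallyEq {f : smoothFunctions (k + m)} {s : Finset A.ι}
    (hs : ∀ a ∉ s, A.smoothWeight a * f = 0) :
    ((∑ a ∈ s, A.smoothWeight a * f : smoothFunctions (k + m)) : (Fin (k + m) → ℝ) → ℝ)
      =ᶠ[𝓝ˢ (zeroSurface P)] f := by
  filter_upwards [A.sum_eq_one] with x hx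
  have h1 : ∀ a ∉ s, A.weight a x * (f : _ → ℝ) x = 0 := fun a ha =>
    congrArg (smoothFunctions.evalHom x) (hs a ha)
  have h2 : smoothFunctions.evalHom x (∑ a ∈ s, A.smoothWeight a * f) =
      ∑ a ∈ s, A.weight a x * (f : _ → ℝ) x := by
    rw [map_sum]
    rfl
  have h3 : ∑ᶠ a, A.weight a x * (f : _ → ℝ) x = ∑ a ∈ s, A.weight a x * (f : _ → ℝ) x :=
    finsum_eq_sum_of_support_subset _ fun a ha => by
      by_contra h
      exact ha (h1 a h)
  rw [← smoothFunctions.evalHom_apply, h2, ← h3, ← finsum_mul' _ _ (A.locallyFinite.point_finite x),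
    hx, one_mul]

theorem delta_eq_sum (I : List (Fin k)) {f : smoothFunctions (k + m)} {s : Finset A.ι}
    (hs : ∀ a ∉ s, A.smoothWeight a * f = 0) (hΩ : OrientsSurface P Ω) :
    A.delta Ω I f = ∑ a ∈ s, (A.chart a).localDelta Ω I
      (A.smoothWeight a * f : smoothFunctions (k + m)) := by
  refine finsum_eq_sum_of_support_subset _ fun a ha => ?_
  by_contra h
  refine ha ?_
  change (A.chart a).localDelta Ω I (A.smoothWeight a * f : smoothFunctions (k + m)) = 0
  rw [hs a h]
  exact map_zero ((A.chart a).localDeltaHom hΩ I)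

/-- The partition of unity of one grid may be inserted into a functional of the other, because the
two surfaces coincide. -/
theorem localDelta_eq_sum_smoothWeight (Φ : AdaptedChart Q) (hΩ : OrientsSurface Q Ω)
    (hS : zeroSurface Q = zeroSurface P) (I : List (Fin k)) {g : smoothFunctions (k + m)}
    (hg : g ∈ compactlySupportedIn Φ.toChart.source) {s : Finset A.ι}
    (hs : ∀ a ∉ s, A.smoothWeight a * g = 0) :
    Φ.localDelta Ω I g =
      ∑ a ∈ s, Φ.localDelta Ω I (A.smoothWeight a * g : smoothFunctions (k + m)) := by
  have hmem := fun a => Ideal.mul_mem_left _ (A.smoothWeight a) hg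
  rw [← Φ.localDelta_sum hΩ I s hmem]
  refine Φ.localDelta_congr_nhdsSet I hg (sum_mem fun a _ => hmem a) ?_
  rw [hS]
  exact (A.sum_smoothWeight_mul_eventuallyEq hs).symm

variable {A} {B : GridAtlas Q}

/-- The transformation law, given an expansion of the corresponding product of linear forms. -/
theorem delta_transform (hΩ : OrientsSurface P Ω)
    (hP : ∀ i, ContDiff ℝ ∞ (P i)) (hQ : ∀ i, ContDiff ℝ ∞ (Q i))
    (hα : ∀ i j, ContDiff ℝ ∞ fun x => α x i j) (hβ : ∀ i j, ContDiff ℝ ∞ fun x => β x i j)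
    (hQP : ∀ i x, Q i x = ∑ j, P j x * α x j i) (hPQ : ∀ i x, P i x = ∑ j, Q j x * β x j i)
    (hβα : ∀ x, β x * α x = 1)
    {τ : Type*} {I : List (Fin k)} {s : Finset τ} {J : τ → List (Fin k)}
    {c : τ → smoothFunctions (k + m)}
    (hexp : (I.map (symbolForm (smoothFunctions.ofMatrix hβ))).prod =
      ∑ t ∈ s, MvPolynomial.C (c t) * ((J t).map MvPolynomial.X).prod)
    {f : smoothFunctions (k + m)} (hf : HasCompactSupport (f : (Fin (k + m) → ℝ) → ℝ)) :
    B.delta Ω I f = ∑ t ∈ s, A.delta Ω (J t)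
      ((smoothFunctions.ofMatrix hβ).det * c t * f : smoothFunctions (k + m)) := by
  have hΩQ : OrientsSurface Q Ω := hΩ.of_combination hP hα hQP hPQ
  have hS : zeroSurface P = zeroSurface Q :=
    (zeroSurface_subset_of_combination hQP).antisymm (zeroSurface_subset_of_combination hPQ)
  obtain ⟨sA, hsA⟩ := A.exists_finset hf
  obtain ⟨sB, hsB⟩ := B.exists_finset hf
  have hcs : ∀ e : smoothFunctions (k + m),
      HasCompactSupport ((e * f : smoothFunctions (k + m)) : (Fin (k + m) → ℝ) → ℝ) := fun e =>
    HasCompactSupport.mul_left (f := (e : (Fin (k + m) → ℝ) → ℝ)) hf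
  have hcomm : ∀ e w w' : smoothFunctions (k + m), w' * (w * (e * f)) = e * (w * (w' * f)) :=
    fun e w w' => by rw [mul_left_comm w' w, mul_left_comm w' e, mul_left_comm w e]
  -- Each piece is refined by the other partition: a product of two weights with `f` is supported in
  -- a chart of each grid, where the local law applies. `hA` refines the other side by the same
  -- products.
  have hB : ∀ b, (B.chart b).localDelta Ω I (B.smoothWeight b * f : smoothFunctions (k + m)) =
      ∑ a ∈ sA, ∑ t ∈ s, (A.chart a).localDelta Ω (J t) ((smoothFunctions.ofMatrix hβ).det * c t *
        (A.smoothWeight a * (B.smoothWeight b * f)) : smoothFunctions (k + m)) := by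
    intro b
    have hmem := B.smoothWeight_mul_mem b hf
    rw [A.localDelta_eq_sum_smoothWeight (B.chart b) hΩQ hS.symm I hmem (s := sA)
      fun a ha => by rw [mul_left_comm, hsA a ha, mul_zero]]
    exact Finset.sum_congr rfl fun a _ => AdaptedChart.localDelta_transform hΩ hP hQ hα hβ hQP hPQ
      hβα hexp (A.smoothWeight_mul_mem a (hcs _))
      (Ideal.mul_mem_left _ _ hmem)
  have hA : ∀ (e : smoothFunctions (k + m)) a t, (A.chart a).localDelta Ω (J t)
      (A.smoothWeight a * (e * f) : smoothFunctions (k + m)) =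
      ∑ b ∈ sB, (A.chart a).localDelta Ω (J t)
        (e * (A.smoothWeight a * (B.smoothWeight b * f)) : smoothFunctions (k + m)) := by
    intro e a t
    rw [B.localDelta_eq_sum_smoothWeight (A.chart a) hΩ hS (J t)
      (A.smoothWeight_mul_mem a (hcs _)) (s := sB)
      fun b hb => by rw [hcomm, hsB b hb, mul_zero, mul_zero]]
    exact Finset.sum_congr rfl fun b _ => by rw [hcomm]
  have hsA' : ∀ e : smoothFunctions (k + m), ∀ a ∉ sA, A.smoothWeight a * (e * f) = 0 :=
    fun e a ha => by rw [mul_left_comm, hsA a ha, mul_zero]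
  rw [B.delta_eq_sum I hsB hΩQ, Finset.sum_congr rfl fun b _ => hB b, Finset.sum_comm,
    Finset.sum_congr rfl fun t _ => A.delta_eq_sum (J t) (hsA' _) hΩ, Finset.sum_comm (s := s)]
  refine Finset.sum_congr rfl fun a _ => ?_
  rw [Finset.sum_comm]
  exact Finset.sum_congr rfl fun t _ => (hA _ a t).symm

end GridAtlas

end Global

/-! ### Expansion of products of linear forms. -/

section Expansion

variable {κ R : Type*} [CommRing R]

theorem prod_map_multiIndexList {k : ℕ} {M : Type*} [CommMonoid M] (F : Fin k → M)
    (q : Fin k → ℕ) : ((multiIndexList q).map F).prod = ∏ i, F i ^ q i := by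
  rw [multiIndexList, List.map_flatMap, Fin.prod_univ_def]
  induction List.finRange k with
  | nil => rfl
  | cons i L ih =>
    rw [List.flatMap_cons, List.prod_append, ih, List.map_cons, List.prod_cons, List.map_replicate,
      List.prod_replicate]

theorem prod_ofFn_symbolForm {k s : ℕ} (β : Matrix (Fin k) (Fin k) R) (i : Fin s → Fin k) :
    ((List.ofFn i).map (symbolForm β)).prod = ∑ j : Fin s → Fin k,
      MvPolynomial.C (∏ a, β (i a) (j a)) * ((List.ofFn j).map MvPolynomial.X).prod := by
  simp only [List.map_ofFn, List.prod_ofFn, Function.comp_apply, symbolForm,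
    Finset.prod_univ_sum, Fintype.piFinset_univ, Finset.prod_mul_distrib, map_prod]

/-- The multinomial theorem is applied to each row `i` separately; the exponent of `X j` then
collects column `j` of `r`. -/
theorem prod_multiIndexList_symbolForm {k : ℕ} (β : Matrix (Fin k) (Fin k) R) (q : Fin k → ℕ) :
    ((multiIndexList q).map (symbolForm β)).prod =
      ∑ r ∈ Fintype.piFinset fun i => Finset.piAntidiag (Finset.univ : Finset (Fin k)) (q i),
        MvPolynomial.C (∏ i, ((Nat.multinomial Finset.univ (r i) : R) * ∏ j, β i j ^ r i j)) *
          ((multiIndexList fun j => ∑ i, r i j).map MvPolynomial.X).prod := by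
  simp only [prod_map_multiIndexList, symbolForm, Finset.sum_pow_eq_sum_piAntidiag,
    Finset.prod_univ_sum]
  refine Finset.sum_congr rfl fun r _ => ?_
  simp only [mul_pow, Finset.prod_mul_distrib, map_prod, map_mul, map_pow, map_natCast, mul_assoc]
  congr 2
  rw [Finset.prod_comm]
  simp only [Finset.prod_pow_eq_pow_sum]

end Expansion

end

theorem theorem2 {k m : ℕ} (P Q : Fin k → (Fin (k + m) → ℝ) → ℝ)
    (α β : (Fin (k + m) → ℝ) → Matrix (Fin k) (Fin k) ℝ)
    (hP : ∀ i, ContDiff ℝ ∞ (P i)) (hQ : ∀ i, ContDiff ℝ ∞ (Q i))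
    (hα : ∀ i j, ContDiff ℝ ∞ fun x => α x i j) (hβ : ∀ i j, ContDiff ℝ ∞ fun x => β x i j)
    (hQP : ∀ i x, Q i x = ∑ j, P j x * α x j i) (hPQ : ∀ i x, P i x = ∑ j, Q j x * β x j i)
    (hαβ : ∀ x, α x * β x = 1) (hβα : ∀ x, β x * α x = 1)
    (hgridP : CorrectGrid P) (hgridQ : CorrectGrid Q)
    (Ω : (Fin (k + m) → ℝ) → (Fin (k + m) → ℝ) [⋀^Fin m]→L[ℝ] ℝ) (hΩ : OrientsSurface P Ω)
    (A : GridAtlas P) (B : GridAtlas Q)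
    (φ : (Fin (k + m) → ℝ) → ℝ) (hφ : ContDiff ℝ ∞ φ) (hφc : HasCompactSupport φ) :
    (∀ (s : ℕ) (i : Fin s → Fin k),
      B.delta Ω (List.ofFn i) φ =
        ∑ j : Fin s → Fin k, A.delta Ω (List.ofFn j)
          fun x => (β x).det * (∏ a, β x (i a) (j a)) * φ x) ∧
    (∀ q : Fin k → ℕ,
      B.delta Ω (multiIndexList q) φ =
        ∑ r ∈ Fintype.piFinset fun i => Finset.piAntidiag (Finset.univ : Finset (Fin k)) (q i),
          A.delta Ω (multiIndexList fun j => ∑ i, r i j)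
            fun x => (β x).det *
              (∏ i, ((q i).factorial : ℝ) * ∏ j, β x i j ^ r i j / ((r i j).factorial : ℝ)) * φ x) := by
  have key := fun {τ : Type} {I : List (Fin k)} {s : Finset τ} {J : τ → List (Fin k)}
    {c : τ → smoothFunctions (k + m)} h =>
    GridAtlas.delta_transform (A := A) (B := B) hΩ hP hQ hα hβ hQP hPQ hβα (τ := τ) (I := I)
      (s := s) (J := J) (c := c) h (f := ⟨φ, smoothFunctions.mem_iff.2 hφ⟩) hφc
  refine ⟨fun s i => ?_, fun q => ?_⟩
  · refine (key (prod_ofFn_symbolForm _ i)).trans (Finset.sum_congr rfl fun j _ => ?_)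
    congr 1
    ext x
    rw [← smoothFunctions.evalHom_apply, map_mul, map_mul, smoothFunctions.evalHom_det, map_prod]
    rfl
  · refine (key (prod_multiIndexList_symbolForm _ q)).trans (Finset.sum_congr rfl fun r hr => ?_)
    congr 1
    ext x
    rw [← smoothFunctions.evalHom_apply, map_mul, map_mul, smoothFunctions.evalHom_det, map_prod]
    refine congrArg₂ _ (congrArg₂ _ rfl (Finset.prod_congr rfl fun i _ => ?_)) rfl
    have hri : ∑ j, r i j = q i := (Finset.mem_piAntidiag.1 (Fintype.mem_piFinset.1 hr i)).1
    -- This turns the multinomial coefficient into `qᵢ! / ∏ⱼ rᵢⱼ!`.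
    have hspec : (∏ j, ((r i j).factorial : ℝ)) * (Nat.multinomial Finset.univ (r i) : ℝ) =
        (q i).factorial := by
      rw [← hri]
      exact_mod_cast Nat.multinomial_spec Finset.univ (r i)
    rw [map_mul, map_natCast, map_prod, ← hspec, Finset.prod_div_distrib]
    have hne : (∏ j, ((r i j).factorial : ℝ)) ≠ 0 :=
      Finset.prod_ne_zero_iff.2 fun j _ => by positivity
    simp only [map_pow, smoothFunctions.evalHom_ofMatrix]
    field_simp
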